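/- Let $RM(r,m)$ be the Reed--Muller code of length $n=2^m$, dimension $k=\sum_{i\le r}\binom mi$ and distance $d=2^{m-r}$. A codeword $c$ is sent as the vector with entries $(-1)^{c_x}$, and $y_x=(-1)^{c_x}+e_x$ is received, where $e\in\mathbb R^n$ is the error pattern; $\|e\|_2$ is its Euclidean weight. *Soft-decision recursive decoding* with noise power $\sigma^2$ starts from the likelihoods $g_x=2y_x/\sigma^2$. At a node $(j,s)$ it decodes $RM(s,j)$ from a likelihood vector $g=(g',g'')$ of length $2^j$. If $s=1$ or $s=j-1$, it performs maximum-likelihood decoding: it outputs a codeword $z$ minimizing the sum of $|g_x|$ over the positions where $z_x$ differs from the hard decision ($0$ if $g_x\ge0$, and $1$ otherwise). In all other cases it (i) finds $v\in RM(s-1,j-1)$ by decoding, at node $(j-1,s-1)$, the likelihoods $\log\frac{1+h}{1-h}$ with $h=\tanh(g'/2)\tanh(g''/2)$ (componentwise); (ii) finds $u\in RM(s,j-1)$ by decoding, at node $(j-1,s)$, the likelihoods $g'+(-1)^{v}g''$; (iii) outputs $(u,u+v)$. An error pattern is *corrected* if the output is the transmitted codeword, however ties are broken. Say that decoding *corrects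 virtually all error patterns of weight $\rho\le B$* along a sequence of codes if, for every $\varepsilon>0$, for all codes far enough in the sequence, for all $0<\rho\le B$ and every transmitted codeword, the uncorrected error patterns of weight $\rho$ have normalized surface measure at most $\varepsilon$ on the sphere $\{e\in\mathbb R^n:\|e\|_2=\rho\}$, where the decoder is run with $\sigma^2=\rho^2/n$. **Corollary.** As $m\to\infty$, soft-decision recursive decoding of $RM(r,m)$ corrects virtually all error patterns of Euclidean weight $\rho\le B$ in the following cases. 1. $r\ge1$ is fixed, and $$B=\sqrt n\,\Big(\frac{d}{2m}\Big)^{1/2^r}.$$ 2. The codes $RM(r_i,m_i)$, with $m_i\to\infty$, have rates $k/n\to R$ for a fixed $0<R<1$, and $$B=(1-\eta)\sqrt{\frac{n}{m\ln 2}}$$ for an arbitrary fixed $\eta>0$. For the codes of the sequence with $2r\le m$ (that is, for all but finitely many of them if $R<1/2$), the factor $1-\eta$ can be omitted. -/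

import Mathlib

open Filter Topology MeasureTheory

noncomputable section

namespace ReedMuller

/-- Positions of a word of length `2 ^ m`: the points of the Boolean cube. -/
abbrev Point (m : ℕ) : Type := Fin m → ZMod 2

/-- Binary words of length `2 ^ m`. -/
abbrev Word (m : ℕ) : Type := Point m → ZMod 2

/-- The Reed-Muller code `RM(r, m)`: the value tables of the polynomials of degree at most `r` in
`m` Boolean variables. -/
def code (r m : ℕ) : Set (Word m) :=
  {z | ∃ p : MvPolynomial (Fin m) (ZMod 2), p.totalDegree ≤ r ∧ ∀ x, z x = MvPolynomial.eval x p}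

/-- The length `n = 2 ^ m`, as a real number. -/
def len (m : ℕ) : ℝ := 2 ^ m

/-- The minimum distance `d = 2 ^ (m - r)` (used for `r ≤ m`), as a real number. -/
def dist (r m : ℕ) : ℝ := 2 ^ (m - r)

/-- The code rate `k / n`, where `k = ∑_{i ≤ r} (m choose i)`. -/
def rate (r m : ℕ) : ℝ := (∑ i ∈ Finset.range (r + 1), (m.choose i : ℝ)) / len m

/-- The transmitted symbol: `0` is sent as `+1` and `1` as `-1`. -/
def modulate (b : ZMod 2) : ℝ := if b = 0 then 1 else -1

/-- The likelihood `g = log (q / p) = 2 y / σ²` of symbol `0`, given the received value `y` on an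
AWGN channel with noise power `σ²`. -/
def likelihood (σsq y : ℝ) : ℝ := 2 * y / σsq

/-- The spread `h = q - p = (e^{g/2} - e^{-g/2}) / (e^{g/2} + e^{-g/2})`. -/
def spread (g : ℝ) : ℝ := Real.tanh (g / 2)

/-- The likelihood `log (q / p)` that has spread `h`, as `q = (1 + h) / 2` and `p = (1 - h) / 2`. -/
def ofSpread (h : ℝ) : ℝ := Real.log ((1 + h) / (1 - h))

/-- The likelihoods on `v = z' + z''`: the spreads of the two halves are multiplied. -/
def combine {j : ℕ} (g : Point (j + 1) → ℝ) : Point j → ℝ := fun x =>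
  ofSpread (spread (g (Fin.cons 0 x)) * spread (g (Fin.cons 1 x)))

/-- The likelihoods on `u` once `v` is found: the signs of the likelihoods of the second half are
changed where `v = 1`, and then the two halves are added. -/
def merge {j : ℕ} (g : Point (j + 1) → ℝ) (v : Word j) : Point j → ℝ := fun x =>
  g (Fin.cons 0 x) + (if v x = 0 then g (Fin.cons 1 x) else -g (Fin.cons 1 x))

/-- The word `(u, u + v)`. -/
def plotkin {j : ℕ} (u v : Word j) : Word (j + 1) := fun x =>
  if x 0 = 0 then u (Fin.tail x) else u (Fin.tail x) + v (Fin.tail x)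

/-- The hard decision. -/
def hard (g : ℝ) : ZMod 2 := if 0 ≤ g then 0 else 1

/-- The sum of `|g|` over the positions at which `z` differs from the hard decisions. -/
def cost {j : ℕ} (g : Point j → ℝ) (z : Word j) : ℝ :=
  ∑ x, if z x ≠ hard (g x) then |g x| else 0

/-- The maximum likelihood decisions in a code `C`; there are several only if there is a tie. -/
def mlOutputs {j : ℕ} (C : Set (Word j)) (g : Point j → ℝ) : Set (Word j) :=
  {z | z ∈ C ∧ ∀ w ∈ C, cost g z ≤ cost g w}

/-- The recursive soft decision decoding of `RM(s, j)` from the likelihoods `g`: the set of its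
possible outputs, over all ways to break ties in the end nodes. The end nodes `(j, 1)` and
`(j, j - 1)` use maximum likelihood decoding. At any other node one first decodes `v` in
`RM(s - 1, j - 1)`, then `u` in `RM(s, j - 1)`, and returns `(u, u + v)`.
(The decoder is used for `1 ≤ s < j` only.) -/
def outputs : (j s : ℕ) → (Point j → ℝ) → Set (Word j)
  | 0, s, g => mlOutputs (code s 0) g
  | j + 1, s, g =>
    if s ≤ 1 ∨ j ≤ s then mlOutputs (code s (j + 1)) g
    else {z | ∃ v ∈ outputs j (s - 1) (combine g), ∃ u ∈ outputs j s (merge g v), z = plotkin u v}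

/-- Error patterns, with the Euclidean norm as their weight. -/
abbrev ErrorPattern (m : ℕ) : Type := EuclideanSpace ℝ (Point m)

/-- The error pattern `e`, added to the transmitted codeword `c` of `RM(r, m)`, is corrected by
the recursive decoder designed for the noise power `σ²`: the output is `c`, whatever way ties are
broken. -/
def Corrects (r m : ℕ) (σsq : ℝ) (c : Word m) (e : ErrorPattern m) : Prop :=
  outputs m r (fun x => likelihood σsq (modulate (c x) + e x)) = {c}

/-- The fraction, in the normalized surface measure on the sphere of radius `ρ`, of the error
patterns of Euclidean weight `ρ` that are not corrected when `c` is transmitted and the decoder is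
run with the noise power `ρ² / n` per symbol. -/
def failureFraction (r m : ℕ) (ρ : ℝ) (c : Word m) : ENNReal :=
  (volume : Measure (ErrorPattern m)).toSphere
      {x | ¬ Corrects r m (ρ ^ 2 / len m) c (ρ • (x : ErrorPattern m))} /
    (volume : Measure (ErrorPattern m)).toSphere Set.univ

end ReedMuller

end

namespace ReedMuller

/-! Multiply every likelihood by the transmitted sign. Because `boxplus` is odd in each argument,
the recursion then runs as if the zero word had been sent, and the output is the transmitted
codeword as soon as the event `Good` holds (`outputs_eq_singleton`). `Good` can fail only at an end
node. There a failure makes the likelihood sum nonpositive over some affine hyperplane (for order 1)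
or over some pair of points (for the single parity check code).

Errors on a sphere are not independent, but each of these events involves at most half of the
received symbols. The uniform law on the sphere, seen through half of the coordinates, is at most 4
times the Gaussian product law (`toSphere_le`). The relation `HalfDominated` carries this comparison
through the recursion, so every probability may be computed on the AWGN channel.

On that channel, the Bhattacharyya parameter `Z` bounds the end node events by powers of `Z`. A step
to `u` squares `Z`; a step to `v` gives at most `2Z - Z²`, as on an erasure channel. The worst path
takes all the steps to `v` first, which gives `measure_not_good_le_erasure`. When the noise is
strong this loses a constant factor in the signal-to-noise ratio. There the mean square spread is
used instead: steps to `v` square it exactly, and it is converted into a bound on `Z` only when the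
run of steps to `v` ends (`measure_not_good_le_exp`).

For fixed order the exponent is about `m`, and `2 ^ m * exp (-m)` tends to 0. For fixed rate,
Chebyshev's inequality gives `r ≤ (1/2 + o(1)) m`. The radius is such that `2 ^ r * Z ≤ 1`, so the
erasure bound is at most `(1/2) ^ 2 ^ (m - r)` up to exponential factors. -/

/-! ### Reed-Muller codes and the Plotkin decomposition. -/

lemma code_add {r m : ℕ} {z w : Word m} (hz : z ∈ code r m) (hw : w ∈ code r m) :
    z + w ∈ code r m := by
  obtain ⟨p, hp, hpz⟩ := hz
  obtain ⟨q, hq, hqw⟩ := hw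
  exact ⟨p + q, (MvPolynomial.totalDegree_add p q).trans (max_le hp hq),
    fun x => by simp [hpz, hqw]⟩

lemma zero_mem_code (r m : ℕ) : (0 : Word m) ∈ code r m := ⟨0, by simp, by simp⟩

lemma code_sum {r m : ℕ} {ι : Type*} (s : Finset ι) (f : ι → Word m)
    (h : ∀ i ∈ s, f i ∈ code r m) : ∑ i ∈ s, f i ∈ code r m :=
  Finset.sum_induction f (· ∈ code r m) (fun _ _ => code_add) (zero_mem_code r m) h

lemma monomial_mem_code {r m : ℕ} (d : Fin m →₀ ℕ) (a : ZMod 2) (hd : d.degree ≤ r) :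
    (fun x => a * d.prod fun i e => x i ^ e) ∈ code r m :=
  ⟨MvPolynomial.monomial d a,
    (MvPolynomial.totalDegree_monomial_le d a).trans hd,
    fun x => by rw [MvPolynomial.eval_monomial]⟩

lemma exists_const_of_mem_code_zero {m : ℕ} {z : Word m} (hz : z ∈ code 0 m) :
    ∃ a, ∀ x, z x = a := by
  obtain ⟨p, hp, hz⟩ := hz
  rw [Nat.le_zero, MvPolynomial.totalDegree_eq_zero_iff_eq_C] at hp
  refine ⟨p.coeff 0, fun x => ?_⟩
  rw [hz, hp]
  simp

lemma add_self_word {m : ℕ} (z : Word m) : z + z = 0 := by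
  funext x
  exact CharTwo.add_self_eq_zero (z x)

/-- Both components of the Plotkin decomposition of a codeword are codewords. -/
lemma exists_plotkin {s j : ℕ} {c : Word (j + 1)} (hs : 1 ≤ s) (hc : c ∈ code s (j + 1)) :
    ∃ u ∈ code s j, ∃ v ∈ code (s - 1) j, c = plotkin u v := by
  obtain ⟨p, hp, hc⟩ := hc
  have key : ∀ d ∈ p.support, (fun x : Point j => MvPolynomial.eval (Fin.cons 0 x)
        (MvPolynomial.monomial d (p.coeff d))) ∈ code s j ∧
      (fun x : Point j => MvPolynomial.eval (Fin.cons 1 x)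
          (MvPolynomial.monomial d (p.coeff d)) - MvPolynomial.eval (Fin.cons 0 x)
          (MvPolynomial.monomial d (p.coeff d))) ∈ code (s - 1) j := by
    intro d hd
    have hdeg : d.degree ≤ s := (MvPolynomial.le_totalDegree hd).trans hp
    have hsplit : d.degree = d 0 + d.tail.degree := by
      simp [Finsupp.degree_eq_sum, Fin.sum_univ_succ, Finsupp.tail_apply]
    have hev : ∀ (b : ZMod 2) (x : Point j), MvPolynomial.eval (Fin.cons b x : Point (j + 1))
        (MvPolynomial.monomial d (p.coeff d)) =
        b ^ d 0 * (p.coeff d * d.tail.prod fun i e => x i ^ e) := by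
      intro b x
      rw [MvPolynomial.eval_monomial, Finsupp.prod_fintype _ _ (by simp),
        Finsupp.prod_fintype _ _ (by simp), Fin.prod_univ_succ]
      simp [Finsupp.tail_apply]
      ring
    simp only [hev]
    -- A monomial free of the first variable contributes only to `u`. Any other monomial vanishes on
    -- the first half, so it contributes only to `v`, and it loses at least one degree there.
    rcases Nat.eq_zero_or_pos (d 0) with h0 | h0
    · simp only [h0, pow_zero, one_mul, sub_self]
      exact ⟨monomial_mem_code _ _ (by omega), zero_mem_code _ _⟩
    · simp only [zero_pow h0.ne', one_pow, one_mul, zero_mul, sub_zero]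
      exact ⟨zero_mem_code _ _, monomial_mem_code _ _ (by omega)⟩
  have hsum : ∀ y, c y = ∑ d ∈ p.support, MvPolynomial.eval y
      (MvPolynomial.monomial d (p.coeff d)) := by
    intro y
    rw [hc, ← map_sum, ← MvPolynomial.as_sum]
  refine ⟨_, code_sum _ _ fun d hd => (key d hd).1, _, code_sum _ _ fun d hd => (key d hd).2, ?_⟩
  funext y
  obtain ⟨b, x, rfl⟩ : ∃ (b : ZMod 2) (x : Point j), y = Fin.cons b x :=
    ⟨y 0, Fin.tail y, (Fin.cons_self_tail y).symm⟩
  rw [hsum]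
  simp only [plotkin, Fin.cons_zero, Fin.tail_cons, Finset.sum_apply]
  have hb : b = 0 ∨ b = 1 := by revert b; decide
  rcases hb with rfl | rfl
  · simp
  · simp

/-! ### Reduction to the zero codeword. -/

/-- Apply a binary operation to the two halves of a vector. -/
def pairMap {j : ℕ} (op : ℝ → ℝ → ℝ) (g : Point (j + 1) → ℝ) : Point j → ℝ := fun x =>
  op (g (Fin.cons 0 x)) (g (Fin.cons 1 x))

/-- The likelihood of the sum of two bits. -/
noncomputable def boxplus (a b : ℝ) : ℝ := ofSpread (spread a * spread b)

/-- All decisions on the way are correct, in terms of the likelihoods of the correct symbols. -/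
def Good : (j s : ℕ) → (Point j → ℝ) → Prop
  | 0, s, g => ∀ z ∈ code s 0, z ≠ 0 → 0 < ∑ x with z x ≠ 0, g x
  | j + 1, s, g =>
    if s ≤ 1 ∨ j ≤ s then ∀ z ∈ code s (j + 1), z ≠ 0 → 0 < ∑ x with z x ≠ 0, g x
    else Good j (s - 1) (pairMap boxplus g) ∧ Good j s (pairMap (· + ·) g)

/-- At a position where `w` and `c` differ, exactly one of them pays `|g x|`; the sign tells which.
Strict positivity of these sums therefore makes `c` the only minimizer, which settles the ties. -/
lemma cost_sub_cost {j : ℕ} (g : Point j → ℝ) (c w : Word j) :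
    cost g w - cost g c = ∑ x with (w + c) x ≠ 0, modulate (c x) * g x := by
  rw [cost, cost, ← Finset.sum_sub_distrib, Finset.sum_filter]
  refine Finset.sum_congr rfl fun x _ => ?_
  have h2 : ∀ a : ZMod 2, a = 0 ∨ a = 1 := by decide
  simp only [Pi.add_apply, hard, modulate]
  have h11 : (1 : ZMod 2) + 1 = 0 := by decide
  rcases le_or_gt 0 (g x) with hg | hg <;> rcases h2 (c x) with hc | hc <;>
    rcases h2 (w x) with hw | hw <;> simp [hc, hw, hg, h11, abs_of_nonneg, abs_of_neg, not_le.2]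

lemma mlOutputs_eq_singleton {j : ℕ} {r : ℕ} {g : Point j → ℝ} {c : Word j}
    (hc : c ∈ code r j)
    (h : ∀ z ∈ code r j, z ≠ 0 → 0 < ∑ x with z x ≠ 0, modulate (c x) * g x) :
    mlOutputs (code r j) g = {c} := by
  have key : ∀ w ∈ code r j, w ≠ c → cost g c < cost g w := by
    intro w hw hwc
    rw [← sub_pos, cost_sub_cost]
    refine h _ (code_add hw hc) fun h0 => hwc ?_
    calc w = w + c + c := by rw [add_assoc, add_self_word, add_zero]
      _ = c := by rw [h0, zero_add]
  ext w
  simp only [mlOutputs, Set.mem_ofPred_eq, Set.mem_singleton_iff]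
  constructor
  · rintro ⟨hw, hmin⟩
    by_contra hwc
    exact (key w hw hwc).not_ge (hmin c hc)
  · rintro rfl
    refine ⟨hc, fun v hv => ?_⟩
    by_cases hvw : v = w
    · rw [hvw]
    · exact (key v hv hvw).le

lemma spread_neg (g : ℝ) : spread (-g) = -spread g := by
  simp [spread, neg_div, Real.tanh_neg]

lemma ofSpread_neg (h : ℝ) : ofSpread (-h) = -ofSpread h := by
  rw [ofSpread, ofSpread, ← Real.log_inv, inv_div, sub_neg_eq_add, ← sub_eq_add_neg]

lemma boxplus_neg_left (a b : ℝ) : boxplus (-a) b = -boxplus a b := by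
  rw [boxplus, boxplus, spread_neg, neg_mul, ofSpread_neg]

lemma boxplus_neg_right (a b : ℝ) : boxplus a (-b) = -boxplus a b := by
  rw [boxplus, boxplus, spread_neg, mul_neg, ofSpread_neg]

/-- The signs of `u` and `u + v` multiply to the sign of `v`, and `boxplus` lets both signs out.
Once `v` is right, `merge` removes its sign from the second half, and both halves carry the sign of
`u`. -/
lemma outputs_eq_singleton {j : ℕ} : ∀ {s : ℕ} {g : Point j → ℝ} {c : Word j}, c ∈ code s j →
    Good j s (fun x => modulate (c x) * g x) → outputs j s g = {c} := by
  induction j with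
  | zero =>
    intro s g c hc hg
    exact mlOutputs_eq_singleton hc hg
  | succ j ih =>
    intro s g c hc hg
    rw [outputs]
    rw [Good] at hg
    split_ifs with hend
    · rw [if_pos hend] at hg
      exact mlOutputs_eq_singleton hc hg
    · rw [if_neg hend] at hg
      obtain ⟨u, hu, v, hv, rfl⟩ := exists_plotkin (by omega) hc
      have h2 : ∀ a : ZMod 2, a = 0 ∨ a = 1 := by decide
      have h11 : (1 : ZMod 2) + 1 = 0 := by decide
      have e0 : ∀ x, plotkin u v (Fin.cons 0 x) = u x := fun x => by simp [plotkin]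
      have e1 : ∀ x, plotkin u v (Fin.cons 1 x) = u x + v x := fun x => by simp [plotkin]
      have hV : outputs j (s - 1) (combine g) = {v} := by
        refine ih hv ?_
        convert hg.1 using 1
        funext x
        simp only [pairMap, e0, e1, combine]
        change _ * boxplus _ _ = _
        rcases h2 (u x) with hu | hu <;> rcases h2 (v x) with hv | hv <;>
          simp [hu, hv, modulate, h11, boxplus_neg_left, boxplus_neg_right]
      have hU : outputs j s (merge g v) = {u} := by
        refine ih hu ?_
        convert hg.2 using 1
        funext x
        simp only [pairMap, e0, e1, merge]
        rcases h2 (u x) with hu | hu <;> rcases h2 (v x) with hv | hv <;>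
          simp [hu, hv, modulate, h11]
        all_goals ring
      rw [hV]
      simp [hU]

/-! ### Failure events at the end nodes. -/

/-- The points of the cube, split by their first coordinate. -/
def halves (j : ℕ) : Point j ⊕ Point j ≃ Point (j + 1) where
  toFun := Sum.elim (fun x => Fin.cons 0 x) (fun x => Fin.cons 1 x)
  invFun y := if y 0 = 0 then .inl (Fin.tail y) else .inr (Fin.tail y)
  left_inv x := by rcases x with x | x <;> simp
  right_inv y := by
    have h2 : ∀ a : ZMod 2, a ≠ 0 → a = 1 := by decide
    by_cases h : y 0 = 0
    · simp only [h, if_true, Sum.elim_inl]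
      rw [← h, Fin.cons_self_tail]
    · simp only [h, if_false, Sum.elim_inr]
      rw [← h2 _ h, Fin.cons_self_tail]

lemma sum_point_succ {M : Type*} [AddCommMonoid M] {j : ℕ} (f : Point (j + 1) → M) :
    ∑ y, f y = ∑ x : Point j, f (Fin.cons 0 x) + ∑ x : Point j, f (Fin.cons 1 x) := by
  rw [← (halves j).sum_comp, Fintype.sum_sum_type]
  rfl

lemma exists_affine {j : ℕ} {z : Word j} (hz : z ∈ code 1 j) :
    ∃ (l : Point j) (b : ZMod 2), ∀ x, z x = ∑ i, l i * x i + b := by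
  induction j with
  | zero => exact ⟨0, z 0, fun x => by simp [Subsingleton.elim x 0]⟩
  | succ j ih =>
    obtain ⟨u, hu, v, hv, rfl⟩ := exists_plotkin le_rfl hz
    obtain ⟨a, ha⟩ := exists_const_of_mem_code_zero hv
    obtain ⟨l, b, hl⟩ := ih hu
    refine ⟨Fin.cons a l, b, fun x => ?_⟩
    have h2 : ∀ a : ZMod 2, a = 0 ∨ a = 1 := by decide
    rw [Fin.sum_univ_succ, plotkin, hl, ha]
    simp only [Fin.cons_zero, Fin.cons_succ, Fin.tail]
    rcases h2 (x 0) with h | h <;> simp [h]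
    ring

lemma sum_eq_zero_of_mem_code {j : ℕ} {z : Word (j + 1)} (hz : z ∈ code j (j + 1)) :
    ∑ x, z x = 0 := by
  induction j with
  | zero =>
    obtain ⟨a, ha⟩ := exists_const_of_mem_code_zero hz
    rw [sum_point_succ]
    simp [ha, CharTwo.add_self_eq_zero]
  | succ j ih =>
    obtain ⟨u, hu, v, hv, rfl⟩ := exists_plotkin (by omega) hz
    rw [sum_point_succ]
    simp only [plotkin, Fin.cons_zero, Fin.tail_cons, if_true, one_ne_zero, if_false,
      Finset.sum_add_distrib]
    rw [← add_assoc, CharTwo.add_self_eq_zero, zero_add]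
    exact ih hv

/-- The points of an affine hyperplane. -/
def hyperplane {j : ℕ} (l : Point j) (b : ZMod 2) : Finset (Point j) :=
  Finset.univ.filter fun x => ∑ i, l i * x i = b

lemma card_point (j : ℕ) : Fintype.card (Point j) = 2 ^ j := by simp [ZMod.card]

lemma sum_hyperplane {j : ℕ} (l : Point j) (g : Point j → ℝ) :
    ∑ x ∈ hyperplane l 0, g x + ∑ x ∈ hyperplane l 1, g x = ∑ x, g x := by
  have h2 : ∀ a : ZMod 2, ¬ a = 0 ↔ a = 1 := by decide
  rw [← Finset.sum_filter_add_sum_filter_not Finset.univ (fun x => ∑ i, l i * x i = 0)]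
  simp only [hyperplane, h2]

/-- Translation along a coordinate `i` with `l i ≠ 0` exchanges the two parallel hyperplanes. -/
lemma two_mul_card_hyperplane {j : ℕ} {l : Point j} (hl : l ≠ 0) (b : ZMod 2) :
    2 * (hyperplane l b).card = 2 ^ j := by
  obtain ⟨i, hi⟩ : ∃ i, l i ≠ 0 := by
    by_contra! h
    exact hl (funext h)
  have h2 : ∀ a : ZMod 2, a ≠ 0 → a = 1 := by decide
  have h11 : (1 : ZMod 2) + 1 = 0 := by decide
  have hflip : ∀ x : Point j, ∑ k, l k * (x + Pi.single i 1 : Point j) k = ∑ k, l k * x k + 1 := by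
    intro x
    simp only [Pi.add_apply, mul_add, Finset.sum_add_distrib]
    simp [Pi.single_apply, h2 _ hi]
  have hinv : ∀ x : Point j, x + Pi.single i 1 + Pi.single i 1 = x := by
    intro x
    rw [add_assoc, ← Pi.single_add, h11, Pi.single_zero, add_zero]
  have hle : ∀ b, (hyperplane l b).card ≤ (hyperplane l (b + 1)).card := by
    intro b
    refine Finset.card_le_card_of_injOn (fun x => x + Pi.single i 1) (fun x hx => ?_)
      fun x _ y _ h => add_right_cancel h
    simp only [hyperplane, Finset.coe_filter, Finset.mem_univ, true_and, Set.mem_ofPred_eq] at hx ⊢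
    rw [hflip, hx]
  have heq : (hyperplane l 0).card = (hyperplane l 1).card := by
    refine le_antisymm ?_ ?_
    · simpa using hle 0
    · simpa [h11] using hle 1
  have hsum : (hyperplane l 0).card + (hyperplane l 1).card = 2 ^ j := by
    have := sum_hyperplane l (fun _ => 1)
    simp only [Finset.sum_const, nsmul_eq_mul, mul_one, Finset.card_univ, card_point] at this
    exact_mod_cast this
  have hb : b = 0 ∨ b = 1 := by revert b; decide
  rcases hb with rfl | rfl <;> omega

/-- A word of order 1 is supported on a hyperplane, except for the all-one word. The latter would
involve every coordinate; its sum is split over two parallel hyperplanes, one of which also has a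
nonpositive sum. Thus half of the coordinates always suffice. -/
lemma exists_hyperplane_of_not_forall_pos {j : ℕ} {g : Point (j + 1) → ℝ}
    (h : ¬ ∀ z ∈ code 1 (j + 1), z ≠ 0 → 0 < ∑ x with z x ≠ 0, g x) :
    ∃ l ≠ 0, ∃ b, ∑ x ∈ hyperplane l b, g x ≤ 0 := by
  push Not at h
  obtain ⟨z, hz, hz0, hle⟩ := h
  obtain ⟨l, b, hl⟩ := exists_affine hz
  have h2 : ∀ a b : ZMod 2, a + b ≠ 0 ↔ a = b + 1 := by decide
  have hb : b = 0 ∨ b = 1 := by clear hl; revert b; decide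
  by_cases hl0 : l = 0
  · subst hl0
    rcases hb with rfl | rfl
    · exact absurd (funext fun x => by simp [hl]) hz0
    · have hall : ∑ x, g x ≤ 0 := by simpa [hl] using hle
      rw [← sum_hyperplane (Pi.single 0 1)] at hall
      have hne : (Pi.single 0 1 : Point (j + 1)) ≠ 0 := by simp
      by_cases h0 : ∑ x ∈ hyperplane (Pi.single 0 1) 0, g x ≤ 0
      · exact ⟨_, hne, 0, h0⟩
      · exact ⟨_, hne, 1, by linarith⟩
  · refine ⟨l, hl0, b + 1, ?_⟩
    simp only [hl, h2] at hle
    exact hle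

/-- If all pairs had positive sums, every entry other than a smallest one would be positive, and
that smallest entry would be outweighed by any other. -/
lemma exists_pair_of_sum_nonpos {ι : Type*} {T : Finset ι} {g : ι → ℝ} (hT : 1 < T.card)
    (h : ∑ x ∈ T, g x ≤ 0) : ∃ x y, x ≠ y ∧ g x + g y ≤ 0 := by
  classical
  by_contra! hpos
  obtain ⟨x, hx, hmin⟩ := T.exists_min_image g (Finset.card_pos.1 (by omega))
  obtain ⟨y, hy, hxy⟩ := Finset.exists_mem_ne hT x
  have hyT : y ∈ T.erase x := Finset.mem_erase.2 ⟨hxy, hy⟩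
  rw [← Finset.add_sum_erase _ _ hx, ← Finset.add_sum_erase _ _ hyT] at h
  have hrest : 0 ≤ ∑ w ∈ (T.erase x).erase y, g w := by
    refine Finset.sum_nonneg fun w hw => ?_
    have hw' := Finset.mem_of_mem_erase hw
    have h1 := hpos x w (Finset.ne_of_mem_erase hw').symm
    have h2 := hmin w (Finset.mem_of_mem_erase hw')
    linarith
  have := hpos x y hxy.symm
  linarith

lemma exists_pair_of_not_forall_pos {j : ℕ} {g : Point (j + 1) → ℝ}
    (h : ¬ ∀ z ∈ code j (j + 1), z ≠ 0 → 0 < ∑ x with z x ≠ 0, g x) :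
    ∃ x y, x ≠ y ∧ g x + g y ≤ 0 := by
  push Not at h
  obtain ⟨z, hz, hz0, hle⟩ := h
  refine exists_pair_of_sum_nonpos ?_ hle
  have heven : ((Finset.univ.filter fun x => z x ≠ 0).card : ZMod 2) = 0 := by
    have h2 : ∀ a : ZMod 2, (if a ≠ 0 then 1 else 0) = a := by decide
    refine Eq.trans ?_ (sum_eq_zero_of_mem_code hz)
    rw [Finset.card_filter, Nat.cast_sum]
    refine Finset.sum_congr rfl fun x _ => ?_
    rw [Nat.cast_ite, Nat.cast_one, Nat.cast_zero, h2]
  have hpos : 0 < (Finset.univ.filter fun x => z x ≠ 0).card := by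
    rw [Finset.card_pos]
    obtain ⟨x, hx⟩ := Function.ne_iff.1 hz0
    exact ⟨x, by simpa using hx⟩
  rw [ZMod.natCast_eq_zero_iff] at heven
  exact Nat.le_of_dvd hpos heven

/-! ### Laws along the recursion and domination on half of the coordinates. -/

/-- The law of `op X Y` for independent `X` and `Y` of law `μ`. -/
noncomputable def pairLaw (op : ℝ → ℝ → ℝ) (μ : Measure ℝ) : Measure ℝ :=
  (μ.prod μ).map fun p => op p.1 p.2

lemma isProbabilityMeasure_pairLaw {op : ℝ → ℝ → ℝ} (hop : Measurable fun p : ℝ × ℝ => op p.1 p.2)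
    (μ : Measure ℝ) [IsProbabilityMeasure μ] : IsProbabilityMeasure (pairLaw op μ) :=
  Measure.isProbabilityMeasure_map hop.aemeasurable

lemma lintegral_pairLaw {op : ℝ → ℝ → ℝ} (hop : Measurable fun p : ℝ × ℝ => op p.1 p.2)
    (μ : Measure ℝ) [SFinite μ] {f : ℝ → ENNReal} (hf : Measurable f) :
    ∫⁻ g, f g ∂pairLaw op μ = ∫⁻ a, ∫⁻ b, f (op a b) ∂μ ∂μ := by
  rw [pairLaw, lintegral_map hf hop, lintegral_prod]
  exact (hf.comp hop).aemeasurable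

lemma measurable_pairMap {op : ℝ → ℝ → ℝ} (hop : Measurable fun p : ℝ × ℝ => op p.1 p.2)
    (j : ℕ) : Measurable (pairMap op : (Point (j + 1) → ℝ) → _) :=
  measurable_pi_lambda _ fun x =>
    have h : Measurable fun g : Point (j + 1) → ℝ => (g (Fin.cons 0 x), g (Fin.cons 1 x)) :=
      (measurable_pi_apply _).prodMk (measurable_pi_apply _)
    hop.comp h

lemma pi_map_pairMap {op : ℝ → ℝ → ℝ} (hop : Measurable fun p : ℝ × ℝ => op p.1 p.2) (j : ℕ)
    (μ : Measure ℝ) [IsProbabilityMeasure μ] :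
    (Measure.pi fun _ : Point (j + 1) => μ).map (pairMap op) =
      Measure.pi fun _ : Point j => pairLaw op μ := by
  have h1 := measurePreserving_arrowProdEquivProdArrow ℝ ℝ (Point j) (fun _ => μ) (fun _ => μ)
  have h2 := measurePreserving_sumPiEquivProdPi_symm (fun _ : Point j ⊕ Point j => μ)
  have h3 := measurePreserving_piCongrLeft (α := fun _ => ℝ) (fun _ : Point (j + 1) => μ) (halves j)
  have h := h3.comp (h2.comp h1)
  rw [← h.map_eq, Measure.map_map (measurable_pairMap hop j) h.measurable]
  have := isProbabilityMeasure_pairLaw hop μ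
  have hpi := Measure.pi_map_pi (X := fun _ : Point j => ℝ × ℝ) (Y := fun _ => ℝ)
    (μ := fun _ => μ.prod μ) (f := fun _ p => op p.1 p.2)
    (hμ := fun _ => by change SigmaFinite (pairLaw op μ); infer_instance)
    fun _ => hop.aemeasurable
  refine Eq.trans ?_ hpi
  congr 1

/-- Up to the factor `C`, events that involve at most half of the coordinates are no likelier
under `ν` than for independent coordinates of law `μ`. -/
def HalfDominated {j : ℕ} (C : ENNReal) (ν : Measure (Point j → ℝ)) (μ : Measure ℝ) : Prop :=
  ∀ (T : Finset (Point j)) (A : Set (Point j → ℝ)), 2 * T.card ≤ 2 ^ j → MeasurableSet A →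
    DependsOn (· ∈ A) (T : Set (Point j)) → ν A ≤ C * Measure.pi (fun _ => μ) A

/-- A coordinate of the shorter vector depends on two coordinates of the vector of double length, so
the fraction of coordinates involved does not grow. -/
lemma HalfDominated.map_pairMap {j : ℕ} {C : ENNReal} {ν : Measure (Point (j + 1) → ℝ)}
    {μ : Measure ℝ} [IsProbabilityMeasure μ] (h : HalfDominated C ν μ) {op : ℝ → ℝ → ℝ}
    (hop : Measurable fun p : ℝ × ℝ => op p.1 p.2) :
    HalfDominated C (ν.map (pairMap op)) (pairLaw op μ) := by
  classical
  intro T A hT hA hdep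
  rw [← pi_map_pairMap hop, Measure.map_apply (measurable_pairMap hop j) hA,
    Measure.map_apply (measurable_pairMap hop j) hA]
  set f : ZMod 2 → Point j → Point (j + 1) := fun b x => Fin.cons b x
  refine h (T.image (f 0) ∪ T.image (f 1)) _ ?_ (measurable_pairMap hop j hA) ?_
  · have := Finset.card_union_le (T.image (f 0)) (T.image (f 1))
    have h0 := Finset.card_image_le (s := T) (f := f 0)
    have h1 := Finset.card_image_le (s := T) (f := f 1)
    rw [pow_succ]
    omega
  · intro x y hxy
    refine hdep fun i hi => ?_
    simp only [Finset.coe_union, Finset.coe_image] at hxy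
    exact congrArg₂ op (hxy _ (Or.inl ⟨i, hi, rfl⟩)) (hxy _ (Or.inr ⟨i, hi, rfl⟩))

/-! ### Bhattacharyya bounds at the end nodes. -/

/-- The Bhattacharyya parameter of a law of likelihoods. -/
noncomputable def bhattacharyya (μ : Measure ℝ) : ENNReal :=
  ∫⁻ g, ENNReal.ofReal (Real.exp (-g / 2)) ∂μ

/-- Chernoff's bound at parameter `-1/2`: the indicator is at most the product of the factors `exp
(-g / 2)`, whose integral factorizes by independence. -/
lemma pi_sum_nonpos_le {ι : Type*} [Fintype ι] (μ : Measure ℝ) [IsProbabilityMeasure μ]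
    (T : Finset ι) :
    Measure.pi (fun _ : ι => μ) {g | ∑ x ∈ T, g x ≤ 0} ≤ bhattacharyya μ ^ T.card := by
  have hm : Measurable fun g : ℝ => ENNReal.ofReal (Real.exp (-g / 2)) := by fun_prop
  have hind := ProbabilityTheory.iIndepFun_pi (μ := fun _ : ι => μ)
    (X := fun _ g => ENNReal.ofReal (Real.exp (-g / 2))) fun _ => hm.aemeasurable
  have hmi : ∀ i : ι, Measurable fun g : ι → ℝ => ENNReal.ofReal (Real.exp (-g i / 2)) :=
    fun i => hm.comp (measurable_pi_apply i)
  have hprod := ProbabilityTheory.lintegral_prod_eq_prod_lintegral_of_indepFun T _ hind hmi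
  have heval : ∀ i : ι, ∫⁻ g, ENNReal.ofReal (Real.exp (-g i / 2)) ∂Measure.pi (fun _ : ι => μ) =
      bhattacharyya μ := fun i =>
    (measurePreserving_eval (fun _ : ι => μ) i).lintegral_comp hm
  have hset : MeasurableSet {g : ι → ℝ | ∑ x ∈ T, g x ≤ 0} :=
    measurableSet_le (by fun_prop) measurable_const
  calc Measure.pi (fun _ : ι => μ) {g | ∑ x ∈ T, g x ≤ 0}
      = ∫⁻ g in {g : ι → ℝ | ∑ x ∈ T, g x ≤ 0}, 1 ∂Measure.pi (fun _ : ι => μ) := by simp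
    _ ≤ ∫⁻ g in {g : ι → ℝ | ∑ x ∈ T, g x ≤ 0}, ∏ i ∈ T, ENNReal.ofReal (Real.exp (-g i / 2))
          ∂Measure.pi (fun _ : ι => μ) := by
        refine setLIntegral_mono' hset fun g hg => ?_
        rw [← ENNReal.ofReal_prod_of_nonneg fun i _ => (Real.exp_pos _).le, ← Real.exp_sum,
          ← Finset.sum_div, Finset.sum_neg_distrib, ENNReal.one_le_ofReal, Real.one_le_exp_iff]
        have : ∑ x ∈ T, g x ≤ 0 := hg
        linarith
    _ ≤ ∫⁻ g, ∏ i ∈ T, ENNReal.ofReal (Real.exp (-g i / 2)) ∂Measure.pi (fun _ : ι => μ) :=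
        setLIntegral_le_lintegral _ _
    _ = bhattacharyya μ ^ T.card := by
        rw [hprod, Finset.prod_congr rfl fun i _ => heval i, Finset.prod_const]

lemma HalfDominated.sum_nonpos_le {j : ℕ} {C : ENNReal} {ν : Measure (Point j → ℝ)}
    {μ : Measure ℝ} [IsProbabilityMeasure μ] (h : HalfDominated C ν μ) {T : Finset (Point j)}
    (hT : 2 * T.card ≤ 2 ^ j) :
    ν {g | ∑ x ∈ T, g x ≤ 0} ≤ C * bhattacharyya μ ^ T.card := by
  refine (h T _ hT (measurableSet_le (by fun_prop) measurable_const) ?_).trans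
    (mul_le_mul_right (pi_sum_nonpos_le μ T) C)
  intro x y hxy
  change (∑ i ∈ T, x i ≤ 0) = (∑ i ∈ T, y i ≤ 0)
  rw [Finset.sum_congr rfl hxy]

lemma measure_not_ml_one_le {j : ℕ} {C : ENNReal} {ν : Measure (Point (j + 1) → ℝ)}
    {μ : Measure ℝ} [IsProbabilityMeasure μ] (h : HalfDominated C ν μ) :
    ν {g | ¬ ∀ z ∈ code 1 (j + 1), z ≠ 0 → 0 < ∑ x with z x ≠ 0, g x} ≤
      C * (2 ^ (j + 2) * bhattacharyya μ ^ 2 ^ j) := by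
  classical
  have hsub : {g : Point (j + 1) → ℝ |
        ¬ ∀ z ∈ code 1 (j + 1), z ≠ 0 → 0 < ∑ x with z x ≠ 0, g x} ⊆
      ⋃ q ∈ (Finset.univ.filter fun q : Point (j + 1) × ZMod 2 => q.1 ≠ 0),
        {g | ∑ x ∈ hyperplane q.1 q.2, g x ≤ 0} := by
    intro g hg
    obtain ⟨l, hl, b, hle⟩ := exists_hyperplane_of_not_forall_pos hg
    simp only [Set.mem_iUnion]
    exact ⟨(l, b), by simpa using hl, hle⟩
  refine (measure_mono hsub).trans ((measure_biUnion_finset_le _ _).trans ?_)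
  have hterm : ∀ q ∈ (Finset.univ.filter fun q : Point (j + 1) × ZMod 2 => q.1 ≠ 0),
      ν {g | ∑ x ∈ hyperplane q.1 q.2, g x ≤ 0} ≤ C * bhattacharyya μ ^ 2 ^ j := by
    intro q hq
    have hc := two_mul_card_hyperplane (Finset.mem_filter.1 hq).2 q.2
    have hc' : (hyperplane q.1 q.2).card = 2 ^ j := by
      rw [pow_succ] at hc
      omega
    rw [← hc']
    exact h.sum_nonpos_le hc.le
  refine (Finset.sum_le_card_nsmul _ _ _ hterm).trans ?_
  rw [nsmul_eq_mul, mul_left_comm]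
  gcongr
  have : (Finset.univ.filter fun q : Point (j + 1) × ZMod 2 => q.1 ≠ 0).card ≤ 2 ^ (j + 2) := by
    refine (Finset.card_filter_le _ _).trans ?_
    rw [Finset.card_univ, Fintype.card_prod, card_point, ZMod.card, pow_succ _ (j + 1)]
  exact_mod_cast this

lemma measure_not_ml_parity_le {j : ℕ} {C : ENNReal} {ν : Measure (Point (j + 1) → ℝ)}
    {μ : Measure ℝ} [IsProbabilityMeasure μ] (h : HalfDominated C ν μ) (hj : 1 ≤ j) :
    ν {g | ¬ ∀ z ∈ code j (j + 1), z ≠ 0 → 0 < ∑ x with z x ≠ 0, g x} ≤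
      C * (4 ^ (j + 1) * bhattacharyya μ ^ 2) := by
  classical
  have hsub : {g : Point (j + 1) → ℝ |
        ¬ ∀ z ∈ code j (j + 1), z ≠ 0 → 0 < ∑ x with z x ≠ 0, g x} ⊆
      ⋃ q ∈ (Finset.univ.filter fun q : Point (j + 1) × Point (j + 1) => q.1 ≠ q.2),
        {g | ∑ x ∈ ({q.1, q.2} : Finset (Point (j + 1))), g x ≤ 0} := by
    intro g hg
    obtain ⟨x, y, hxy, hle⟩ := exists_pair_of_not_forall_pos hg
    simp only [Set.mem_iUnion]
    refine ⟨(x, y), by simpa using hxy, ?_⟩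
    simpa [Finset.sum_pair hxy] using hle
  refine (measure_mono hsub).trans ((measure_biUnion_finset_le _ _).trans ?_)
  have hterm : ∀ q ∈ (Finset.univ.filter fun q : Point (j + 1) × Point (j + 1) => q.1 ≠ q.2),
      ν {g | ∑ x ∈ ({q.1, q.2} : Finset (Point (j + 1))), g x ≤ 0} ≤
        C * bhattacharyya μ ^ 2 := by
    intro q hq
    have hc := Finset.card_pair (Finset.mem_filter.1 hq).2
    have := h.sum_nonpos_le (T := {q.1, q.2}) (by
      rw [hc]
      calc 2 * 2 = 2 ^ (1 + 1) := rfl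
        _ ≤ 2 ^ (j + 1) := Nat.pow_le_pow_right (by norm_num) (by omega))
    rwa [hc] at this
  refine (Finset.sum_le_card_nsmul _ _ _ hterm).trans ?_
  rw [nsmul_eq_mul, mul_left_comm]
  gcongr
  have : (Finset.univ.filter fun q : Point (j + 1) × Point (j + 1) => q.1 ≠ q.2).card ≤
      4 ^ (j + 1) := by
    refine (Finset.card_filter_le _ _).trans ?_
    rw [Finset.card_univ, Fintype.card_prod, card_point, ← mul_pow]
    norm_num
  exact_mod_cast this

/-! ### Symmetric laws and their stability under both steps. -/

lemma spread_eq (g : ℝ) : spread g = (1 - Real.exp (-g)) / (1 + Real.exp (-g)) := by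
  have h1 : Real.exp (-g) = Real.exp (-(g / 2)) * Real.exp (-(g / 2)) := by
    rw [← Real.exp_add]
    ring_nf
  have h2 : Real.exp (g / 2) * Real.exp (-(g / 2)) = 1 := by
    rw [← Real.exp_add]
    simp
  have h3 := Real.exp_pos (g / 2)
  have h4 := Real.exp_pos (-(g / 2))
  rw [spread, Real.tanh_eq_sinh_div_cosh, Real.sinh_eq, Real.cosh_eq, h1,
    div_eq_div_iff (by positivity) (by positivity)]
  linear_combination Real.exp (-(g / 2)) * h2

lemma exp_neg_boxplus (a b : ℝ) : Real.exp (-boxplus a b) =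
    (Real.exp (-a) + Real.exp (-b)) / (1 + Real.exp (-a) * Real.exp (-b)) := by
  have ha := Real.exp_pos (-a)
  have hb := Real.exp_pos (-b)
  have key : (1 + spread a * spread b) / (1 - spread a * spread b) =
      (1 + Real.exp (-a) * Real.exp (-b)) / (Real.exp (-a) + Real.exp (-b)) := by
    have h1 : 1 - spread a * spread b = 2 * (Real.exp (-a) + Real.exp (-b)) /
        ((1 + Real.exp (-a)) * (1 + Real.exp (-b))) := by
      rw [spread_eq, spread_eq]
      field_simp
      ring
    have h2 : 1 + spread a * spread b = 2 * (1 + Real.exp (-a) * Real.exp (-b)) /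
        ((1 + Real.exp (-a)) * (1 + Real.exp (-b))) := by
      rw [spread_eq, spread_eq]
      field_simp
      ring
    rw [h1, h2]
    field_simp
  rw [boxplus, ofSpread, key, Real.exp_neg, Real.exp_log (by positivity), inv_div]

lemma spread_boxplus (a b : ℝ) : spread (boxplus a b) = spread a * spread b := by
  have ha := Real.exp_pos (-a)
  have hb := Real.exp_pos (-b)
  rw [spread_eq (boxplus a b), exp_neg_boxplus, spread_eq, spread_eq]
  field_simp
  ring

lemma measurable_spread : Measurable spread := by
  have : spread = fun g => (1 - Real.exp (-g)) / (1 + Real.exp (-g)) := funext spread_eq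
  rw [this]
  fun_prop

lemma measurable_boxplus : Measurable fun p : ℝ × ℝ => boxplus p.1 p.2 := by
  have h : Measurable fun p : ℝ × ℝ => spread p.1 * spread p.2 :=
    (measurable_spread.comp measurable_fst).mul (measurable_spread.comp measurable_snd)
  exact Real.measurable_log.comp ((h.const_add 1).div (h.const_sub 1))

/-- The likelihood ratio `p / q`. -/
noncomputable def ratio (g : ℝ) : ENNReal := ENNReal.ofReal (Real.exp (-g))

lemma measurable_ratio : Measurable ratio := by
  unfold ratio
  fun_prop

/-- The symmetry property of the law of the likelihood of a symbol `0`. -/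
def IsSymmetricLaw (μ : Measure ℝ) : Prop :=
  ∀ f : ℝ → ENNReal, Measurable f → ∫⁻ g, f (-g) ∂μ = ∫⁻ g, f g * ratio g ∂μ

namespace IsSymmetricLaw

variable {μ : Measure ℝ}

lemma flip_right (h : IsSymmetricLaw μ) {F : ℝ → ℝ → ENNReal}
    (hF : Measurable (Function.uncurry F)) :
    ∫⁻ a, ∫⁻ b, F a (-b) ∂μ ∂μ = ∫⁻ a, ∫⁻ b, F a b * ratio b ∂μ ∂μ :=
  lintegral_congr fun a => h (F a) (hF.of_uncurry_left)

variable [SFinite μ]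

lemma flip_left (h : IsSymmetricLaw μ) {F : ℝ → ℝ → ENNReal}
    (hF : Measurable (Function.uncurry F)) :
    ∫⁻ a, ∫⁻ b, F (-a) b ∂μ ∂μ = ∫⁻ a, ∫⁻ b, F a b * ratio a ∂μ ∂μ := by
  rw [h (fun a => ∫⁻ b, F a b ∂μ) hF.lintegral_prod_right']
  refine lintegral_congr fun a => ?_
  have hFa : Measurable fun b => F a b := hF.of_uncurry_left
  rw [lintegral_mul_const _ hFa]

lemma flip_both (h : IsSymmetricLaw μ) {F : ℝ → ℝ → ENNReal}
    (hF : Measurable (Function.uncurry F)) :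
    ∫⁻ a, ∫⁻ b, F (-a) (-b) ∂μ ∂μ = ∫⁻ a, ∫⁻ b, F a b * ratio a * ratio b ∂μ ∂μ := by
  have h1 : Measurable (Function.uncurry fun a b => F a (-b)) :=
    hF.comp (measurable_fst.prodMk measurable_snd.neg)
  have h2 : Measurable (Function.uncurry fun a b => F a b * ratio a) :=
    hF.mul (measurable_ratio.comp measurable_fst)
  rw [h.flip_left (F := fun a b => F a (-b)) h1]
  exact h.flip_right h2

lemma pairLaw_add (h : IsSymmetricLaw μ) : IsSymmetricLaw (pairLaw (· + ·) μ) := by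
  have hop : Measurable fun p : ℝ × ℝ => p.1 + p.2 := by fun_prop
  intro f hf
  have hfn : Measurable fun g => f (-g) := hf.comp measurable_neg
  have hfr : Measurable fun g => f g * ratio g := hf.mul measurable_ratio
  rw [lintegral_pairLaw hop μ hfn,
    lintegral_pairLaw hop μ hfr]
  have := h.flip_both (F := fun a b => f (a + b)) (hf.comp hop)
  refine Eq.trans (lintegral_congr fun a => lintegral_congr fun b => ?_)
    (this.trans (lintegral_congr fun a => lintegral_congr fun b => ?_))
  · rw [neg_add]
  · rw [mul_assoc, ratio, ratio, ratio, ← ENNReal.ofReal_mul (Real.exp_pos _).le, ← Real.exp_add,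
      neg_add]

/-- Averaging over the change of both signs. -/
lemma two_mul_of_even (h : IsSymmetricLaw μ) {F : ℝ → ℝ → ENNReal}
    (hF : Measurable (Function.uncurry F)) (heven : ∀ a b, F (-a) (-b) = F a b) :
    2 * ∫⁻ a, ∫⁻ b, F a b ∂μ ∂μ = ∫⁻ a, ∫⁻ b, F a b * (1 + ratio a * ratio b) ∂μ ∂μ := by
  have h1 := h.flip_both hF
  simp only [heven] at h1
  rw [two_mul]
  nth_rewrite 2 [h1]
  have hFi : Measurable fun a => ∫⁻ b, F a b ∂μ := hF.lintegral_prod_right'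
  rw [← lintegral_add_left hFi]
  refine lintegral_congr fun a => ?_
  have hFa : Measurable fun b => F a b := hF.of_uncurry_left
  rw [← lintegral_add_left hFa]
  refine lintegral_congr fun b => ?_
  ring

lemma ratio_boxplus_mul (a b : ℝ) :
    ratio (boxplus a b) * (1 + ratio a * ratio b) = ratio a + ratio b := by
  have ha := Real.exp_pos (-a)
  have hb := Real.exp_pos (-b)
  rw [ratio, ratio, ratio, ← ENNReal.ofReal_mul ha.le, ← ENNReal.ofReal_one,
    ← ENNReal.ofReal_add zero_le_one (by positivity), ← ENNReal.ofReal_mul (Real.exp_pos _).le,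
    ← ENNReal.ofReal_add ha.le hb.le, exp_neg_boxplus, div_mul_cancel₀ _ (by positivity)]

/-- `boxplus` is unchanged when both signs change, so averaging introduces the weight `1 + ratio a *
ratio b`. By `ratio_boxplus_mul` this weight turns `ratio (boxplus a b)` into `ratio a + ratio b`;
each term is what a change of one sign produces. -/
lemma pairLaw_boxplus (h : IsSymmetricLaw μ) : IsSymmetricLaw (pairLaw boxplus μ) := by
  intro f hf
  have hfn : Measurable fun g => f (-g) := hf.comp measurable_neg
  have hfr : Measurable fun g => f g * ratio g := hf.mul measurable_ratio
  rw [lintegral_pairLaw measurable_boxplus μ hfn,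
    lintegral_pairLaw measurable_boxplus μ hfr]
  have hm : Measurable (Function.uncurry fun a b => f (boxplus a b)) :=
    hf.comp measurable_boxplus
  have hl := h.flip_left hm
  have hr := h.flip_right hm
  simp only [boxplus_neg_left, boxplus_neg_right] at hl hr
  have hk := h.two_mul_of_even
    (F := fun a b => f (boxplus a b) * ratio (boxplus a b))
    (hm.mul (measurable_ratio.comp measurable_boxplus)) fun a b => by
      simp only [boxplus_neg_left, boxplus_neg_right, neg_neg]
  have hsum : ∫⁻ a, ∫⁻ b, f (boxplus a b) * ratio (boxplus a b) *
      (1 + ratio a * ratio b) ∂μ ∂μ =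
      2 * ∫⁻ a, ∫⁻ b, f (-boxplus a b) ∂μ ∂μ := by
    have hu : Measurable (Function.uncurry fun a b => f (boxplus a b) * ratio a) :=
      hm.mul (measurable_ratio.comp measurable_fst)
    have hui : Measurable fun a => ∫⁻ b, f (boxplus a b) * ratio a ∂μ :=
      hu.lintegral_prod_right'
    refine Eq.trans ?_ ((two_mul _).trans (congrArg₂ (· + ·) hl hr)).symm
    refine Eq.trans ?_ (lintegral_add_left hui _)
    refine lintegral_congr fun a => ?_
    have hua : Measurable fun b => f (boxplus a b) * ratio a :=
      hu.of_uncurry_left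
    change _ = ∫⁻ b, f (boxplus a b) * ratio a ∂μ +
      ∫⁻ b, f (boxplus a b) * ratio b ∂μ
    rw [← lintegral_add_left hua]
    refine lintegral_congr fun b => ?_
    rw [mul_assoc, ratio_boxplus_mul, mul_add]
  rw [hsum] at hk
  exact ((ENNReal.mul_right_inj two_ne_zero ENNReal.ofNat_ne_top).1 hk).symm

end IsSymmetricLaw

/-! ### Evolution of the Bhattacharyya parameter and of the mean square spread. -/

lemma measurable_exp_half : Measurable fun g : ℝ => ENNReal.ofReal (Real.exp (-g / 2)) := by
  fun_prop

lemma bhattacharyya_add (μ : Measure ℝ) [SFinite μ] :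
    bhattacharyya (pairLaw (· + ·) μ) = bhattacharyya μ ^ 2 := by
  rw [bhattacharyya, lintegral_pairLaw (by fun_prop) μ measurable_exp_half]
  have : ∀ a b : ℝ, ENNReal.ofReal (Real.exp (-(a + b) / 2)) =
      ENNReal.ofReal (Real.exp (-a / 2)) * ENNReal.ofReal (Real.exp (-b / 2)) := by
    intro a b
    rw [← ENNReal.ofReal_mul (Real.exp_pos _).le, ← Real.exp_add]
    ring_nf
  simp only [this]
  simp_rw [lintegral_const_mul _ measurable_exp_half]
  rw [lintegral_mul_const _ measurable_exp_half, sq, bhattacharyya]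

/-- Arikan's inequality for the combination of two binary channels. -/
lemma combine_channels_le {S a b : ℝ} (ha : 0 < a) (hb : 0 < b)
    (h : S ^ 2 * (1 + a ^ 2 * b ^ 2) = a ^ 2 + b ^ 2) :
    S * (1 + a ^ 2 * b ^ 2) + 2 * (a * b) ≤ a + b + a ^ 2 * b + a * b ^ 2 := by
  have hab := mul_pos ha hb
  have hR : 0 ≤ a + b + a ^ 2 * b + a * b ^ 2 - 2 * (a * b) := by
    nlinarith [mul_nonneg ha.le (sq_nonneg (1 - b)), mul_nonneg hb.le (sq_nonneg (1 - a))]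
  have hsq : (S * (1 + a ^ 2 * b ^ 2)) ^ 2 ≤
      (a + b + a ^ 2 * b + a * b ^ 2 - 2 * (a * b)) ^ 2 := by
    have h1 : (S * (1 + a ^ 2 * b ^ 2)) ^ 2 = (a ^ 2 + b ^ 2) * (1 + a ^ 2 * b ^ 2) := by
      rw [← h]
      ring
    have h2 := mul_nonneg hab.le (sq_nonneg (1 + a * b - a - b))
    rw [h1]
    linear_combination 2 * h2
  have := abs_le_of_sq_le_sq hsq hR
  linarith [le_abs_self (S * (1 + a ^ 2 * b ^ 2))]

lemma IsSymmetricLaw.lintegral_ratio {μ : Measure ℝ} [IsProbabilityMeasure μ]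
    (h : IsSymmetricLaw μ) : ∫⁻ g, ratio g ∂μ = 1 := by
  simpa using (h (fun _ => 1) measurable_const).symm

/-- After averaging over the change of both signs, the inequality holds pointwise by
`combine_channels_le`. The terms on the right integrate to `4Z` because `ratio` has integral 1.
Equality would be the erasure channel. -/
lemma IsSymmetricLaw.bhattacharyya_boxplus_add_sq_le {μ : Measure ℝ} [IsProbabilityMeasure μ]
    (h : IsSymmetricLaw μ) :
    bhattacharyya (pairLaw boxplus μ) + bhattacharyya μ ^ 2 ≤ 2 * bhattacharyya μ := by
  set t : ℝ → ENNReal := fun g => ENNReal.ofReal (Real.exp (-g / 2)) with ht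
  have htm : Measurable t := measurable_exp_half
  have hZ : bhattacharyya μ = ∫⁻ g, t g ∂μ := rfl
  have hm : Measurable (Function.uncurry fun a b => t (boxplus a b)) :=
    htm.comp measurable_boxplus
  have h2 := h.two_mul_of_even hm fun a b => by
    simp only [boxplus_neg_left, boxplus_neg_right, neg_neg]
  have hpt : ∀ a b, t (boxplus a b) * (1 + ratio a * ratio b) + 2 * (t a * t b) ≤
      t a + t b + ratio a * t b + t a * ratio b := by
    intro a b
    have hx : ∀ g : ℝ, Real.exp (-g) = Real.exp (-g / 2) ^ 2 := by
      intro g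
      rw [← Real.exp_nat_mul]
      push_cast
      ring_nf
    have hA := Real.exp_pos (-a / 2)
    have hB := Real.exp_pos (-b / 2)
    have hS := Real.exp_pos (-boxplus a b / 2)
    have key := combine_channels_le (S := Real.exp (-boxplus a b / 2)) hA hB (by
      rw [← hx, exp_neg_boxplus, hx, hx]
      exact div_mul_cancel₀ _ (by positivity))
    simp only [ht, ratio, hx]
    rw [show (2 : ENNReal) = ENNReal.ofReal 2 by simp, ← ENNReal.ofReal_one]
    have p1 := sq_nonneg (Real.exp (-a / 2))
    rw [← ENNReal.ofReal_mul p1, ← ENNReal.ofReal_add zero_le_one (by positivity),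
      ← ENNReal.ofReal_mul hS.le, ← ENNReal.ofReal_mul hA.le, ← ENNReal.ofReal_mul zero_le_two,
      ← ENNReal.ofReal_mul p1, ← ENNReal.ofReal_mul hA.le,
      ← ENNReal.ofReal_add (by positivity) (by positivity),
      ← ENNReal.ofReal_add (by positivity) (by positivity),
      ← ENNReal.ofReal_add (by positivity) (by positivity),
      ← ENNReal.ofReal_add (by positivity) (by positivity)]
    exact ENNReal.ofReal_le_ofReal key
  have hint := lintegral_mono (μ := μ) fun a => lintegral_mono (μ := μ) (hpt a)
  have hL : ∫⁻ a, ∫⁻ b, t (boxplus a b) * (1 + ratio a * ratio b) + 2 * (t a * t b)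
      ∂μ ∂μ = 2 * bhattacharyya (pairLaw boxplus μ) + 2 * bhattacharyya μ ^ 2 := by
    have e : ∀ a, ∫⁻ b, t (boxplus a b) * (1 + ratio a * ratio b) + 2 * (t a * t b) ∂μ =
        ∫⁻ b, t (boxplus a b) * (1 + ratio a * ratio b) ∂μ +
          2 * (t a * bhattacharyya μ) := by
      intro a
      rw [lintegral_add_right _ (by fun_prop), lintegral_const_mul _ (by fun_prop),
        lintegral_const_mul _ htm, hZ]
    simp only [e]
    rw [lintegral_add_right _ (by fun_prop), lintegral_const_mul _ (by fun_prop),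
      lintegral_mul_const _ htm, ← h2, ← hZ, sq,
      ← lintegral_pairLaw measurable_boxplus μ measurable_exp_half, ← bhattacharyya]
  have hR : ∫⁻ a, ∫⁻ b, t a + t b + ratio a * t b + t a * ratio b ∂μ ∂μ =
      2 * (2 * bhattacharyya μ) := by
    have e : ∀ a, ∫⁻ b, t a + t b + ratio a * t b + t a * ratio b ∂μ =
        t a + bhattacharyya μ + ratio a * bhattacharyya μ + t a := by
      intro a
      rw [lintegral_add_right _ (measurable_ratio.const_mul _),
        lintegral_add_right _ (htm.const_mul _), lintegral_add_right _ htm,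
        lintegral_const_mul _ htm, lintegral_const_mul _ measurable_ratio, h.lintegral_ratio,
        lintegral_const, measure_univ, mul_one, hZ]
    simp only [e]
    rw [lintegral_add_right _ htm, lintegral_add_right _ (measurable_ratio.mul_const _),
      lintegral_add_right _ measurable_const, lintegral_mul_const _ measurable_ratio,
      h.lintegral_ratio, lintegral_const, measure_univ, mul_one, one_mul, ← hZ]
    ring
  have hfin : 2 * (bhattacharyya (pairLaw boxplus μ) + bhattacharyya μ ^ 2) ≤
      2 * (2 * bhattacharyya μ) := by
    rw [mul_add, ← hL, ← hR]
    exact hint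
  exact (ENNReal.mul_le_mul_iff_right two_ne_zero ENNReal.ofNat_ne_top).1 hfin

/-- The mean square of the spread. -/
noncomputable def sqSpread (μ : Measure ℝ) : ENNReal := ∫⁻ g, ENNReal.ofReal (spread g ^ 2) ∂μ

lemma sqSpread_boxplus (μ : Measure ℝ) [SFinite μ] :
    sqSpread (pairLaw boxplus μ) = sqSpread μ ^ 2 := by
  have hm : Measurable fun g => ENNReal.ofReal (spread g ^ 2) :=
    (measurable_spread.pow_const 2).ennreal_ofReal
  rw [sqSpread, lintegral_pairLaw measurable_boxplus μ hm]
  simp only [spread_boxplus, mul_pow, ENNReal.ofReal_mul (sq_nonneg _)]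
  simp_rw [lintegral_const_mul _ hm]
  rw [lintegral_mul_const _ hm, sq, sqSpread]

/-- Symmetrization turns the integrand `exp (-g / 2)` into `2F = 1 / cosh (g / 2) = √(1 - h²)`,
where `h` is the spread, and `√(1 - h²) ≤ 1 - h² / 2`. -/
lemma IsSymmetricLaw.bhattacharyya_add_sqSpread_le {μ : Measure ℝ} [IsProbabilityMeasure μ]
    (h : IsSymmetricLaw μ) : bhattacharyya μ + sqSpread μ / 2 ≤ 1 := by
  set F : ℝ → ENNReal := fun g => ENNReal.ofReal (Real.exp (-g / 2) / (1 + Real.exp (-g))) with hF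
  have hFm : Measurable F := by fun_prop
  have hx : ∀ g : ℝ, Real.exp (-g) = Real.exp (-g / 2) ^ 2 := by
    intro g
    rw [← Real.exp_nat_mul]
    push_cast
    ring_nf
  have heven : ∀ g, F (-g) = F g := by
    intro g
    have h1 : Real.exp (-(-g) / 2) * Real.exp (-g / 2) = 1 := by
      rw [← Real.exp_add]
      ring_nf
      simp
    have h2 := Real.exp_pos (-g / 2)
    have h3 := Real.exp_pos (-(-g) / 2)
    have h4 : Real.exp (-(-g) / 2) / (1 + Real.exp (-(-g) / 2) ^ 2) =
        Real.exp (-g / 2) / (1 + Real.exp (-g / 2) ^ 2) := by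
      rw [div_eq_div_iff (by positivity) (by positivity)]
      linear_combination (Real.exp (-g / 2) - Real.exp (-(-g) / 2)) * h1
    simp only [hF, hx, h4]
  have hsym := h F hFm
  simp only [heven] at hsym
  have hZ : bhattacharyya μ = ∫⁻ g, 2 * F g ∂μ := by
    rw [lintegral_const_mul _ hFm, two_mul]
    nth_rewrite 2 [hsym]
    rw [← lintegral_add_left hFm, bhattacharyya]
    refine lintegral_congr fun g => ?_
    have h2 := Real.exp_pos (-g / 2)
    have h3 := Real.exp_pos (-g)
    simp only [hF, ratio]
    rw [← ENNReal.ofReal_mul (by positivity), ← ENNReal.ofReal_add (by positivity) (by positivity)]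
    congr 1
    field_simp
  have hsm : Measurable fun g => ENNReal.ofReal (spread g ^ 2) :=
    (measurable_spread.pow_const 2).ennreal_ofReal
  rw [hZ, sqSpread, div_eq_mul_inv, ← lintegral_mul_const _ hsm,
    ← lintegral_add_left (hFm.const_mul 2)]
  have hle : ∀ g, 2 * F g + ENNReal.ofReal (spread g ^ 2) * 2⁻¹ ≤ 1 := by
    intro g
    have h2 := Real.exp_pos (-g / 2)
    simp only [hF, spread_eq]
    rw [show (2 : ENNReal)⁻¹ = ENNReal.ofReal 2⁻¹ by
        rw [ENNReal.ofReal_inv_of_pos two_pos]; simp,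
      show (2 : ENNReal) = ENNReal.ofReal 2 by simp, ← ENNReal.ofReal_mul (sq_nonneg _),
      ← ENNReal.ofReal_mul zero_le_two, ← ENNReal.ofReal_add (by positivity) (by positivity),
      ENNReal.ofReal_le_one, hx]
    set s := Real.exp (-g / 2)
    have : 1 - (2 * (s / (1 + s ^ 2)) + ((1 - s ^ 2) / (1 + s ^ 2)) ^ 2 * 2⁻¹) =
        ((1 - s) ^ 2 / (1 + s ^ 2)) ^ 2 / 2 := by
      field_simp
      ring
    have h0 : 0 ≤ ((1 - s) ^ 2 / (1 + s ^ 2)) ^ 2 / 2 := by positivity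
    linarith
  calc ∫⁻ g, (2 * F g + ENNReal.ofReal (spread g ^ 2) * 2⁻¹) ∂μ ≤ ∫⁻ _, 1 ∂μ :=
        lintegral_mono hle
    _ = 1 := by simp

lemma IsSymmetricLaw.bhattacharyya_boxplus_le {μ : Measure ℝ} [IsProbabilityMeasure μ]
    (h : IsSymmetricLaw μ) {z : ℝ} (h0 : 0 ≤ z) (h1 : z ≤ 1)
    (hz : bhattacharyya μ ≤ ENNReal.ofReal z) :
    bhattacharyya (pairLaw boxplus μ) ≤ ENNReal.ofReal (2 * z - z ^ 2) := by
  have key := h.bhattacharyya_boxplus_add_sq_le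
  have hne : bhattacharyya μ ≠ ⊤ := ne_top_of_le_ne_top ENNReal.ofReal_ne_top hz
  have hne' : bhattacharyya (pairLaw boxplus μ) ≠ ⊤ :=
    ne_top_of_le_ne_top (ENNReal.mul_ne_top ENNReal.ofNat_ne_top hne) (le_self_add.trans key)
  obtain ⟨a, ha⟩ : ∃ a : NNReal, (a : ENNReal) = _ := ⟨_, ENNReal.coe_toNNReal hne⟩
  obtain ⟨b, hb⟩ : ∃ b : NNReal, (b : ENNReal) = _ := ⟨_, ENNReal.coe_toNNReal hne'⟩
  rw [← ha, ← hb] at key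
  rw [← ha] at hz
  rw [← hb]
  have hz' : (a : ℝ) ≤ z := by
    have := ENNReal.toReal_mono ENNReal.ofReal_ne_top hz
    rwa [ENNReal.toReal_ofReal h0] at this
  have key' : (b : ℝ) + (a : ℝ) ^ 2 ≤ 2 * a := by exact_mod_cast key
  rw [← ENNReal.ofReal_coe_nnreal]
  exact ENNReal.ofReal_le_ofReal (by nlinarith)

lemma IsSymmetricLaw.bhattacharyya_le_of_le_sqSpread {μ : Measure ℝ} [IsProbabilityMeasure μ]
    (h : IsSymmetricLaw μ) {x : ℝ} (h0 : 0 ≤ x) (hx : ENNReal.ofReal x ≤ sqSpread μ) :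
    bhattacharyya μ ≤ ENNReal.ofReal (1 - x / 2) := by
  have key := (add_le_add_right (ENNReal.div_le_div_right hx 2) (bhattacharyya μ)).trans
    h.bhattacharyya_add_sqSpread_le
  rw [show (2 : ENNReal) = ENNReal.ofReal 2 by simp, ← ENNReal.ofReal_div_of_pos two_pos] at key
  rw [ENNReal.ofReal_sub _ (by positivity), ENNReal.ofReal_one]
  exact ENNReal.le_sub_of_add_le_right ENNReal.ofReal_ne_top key

/-! ### Recursive bounds on the failure probability. -/

/-- The recursive step of the union bound. -/
lemma measure_not_good_succ_le {j s : ℕ} (ν : Measure (Point (j + 1) → ℝ))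
    (h : ¬ (s ≤ 1 ∨ j ≤ s)) :
    ν {g | ¬ Good (j + 1) s g} ≤ ν.map (pairMap boxplus) {g | ¬ Good j (s - 1) g} +
      ν.map (pairMap (· + ·)) {g | ¬ Good j s g} := by
  have hsub : {g | ¬ Good (j + 1) s g} ⊆ pairMap boxplus ⁻¹' {g | ¬ Good j (s - 1) g} ∪
      pairMap (· + ·) ⁻¹' {g | ¬ Good j s g} := by
    intro g hg
    change ¬ Good (j + 1) s g at hg
    rw [Good, if_neg h, not_and_or] at hg
    exact hg
  refine (measure_mono hsub).trans ((measure_union_le _ _).trans (add_le_add ?_ ?_))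
  -- This inequality holds for arbitrary sets, so the measurability of `Good` is never needed.
  · exact Measure.le_map_apply (measurable_pairMap measurable_boxplus j).aemeasurable _
  · exact Measure.le_map_apply
      (measurable_pairMap (op := fun x y => x + y) (by fun_prop) j).aemeasurable _

/-- The exponent `2 ^ (j + 1 - s)` is the minimum distance: `2 ^ j` points of a hyperplane if `s =
1`, two points if `s = j`. The prefactor covers the number of hyperplanes and of pairs, and by
`count_add_le` it also survives the summation over the two children of a node. -/
lemma measure_not_good_end_le {j s : ℕ} {C : ENNReal} {ν : Measure (Point (j + 1) → ℝ)}
    {μ : Measure ℝ} [IsProbabilityMeasure μ] (h : HalfDominated C ν μ) (hs : 1 ≤ s) (hsj : s ≤ j)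
    (hend : s ≤ 1 ∨ j ≤ s) {z b : ℝ} (hz0 : 0 ≤ z)
    (hz : bhattacharyya μ ≤ ENNReal.ofReal z) (hb : z ^ 2 ^ (j + 1 - s) ≤ b) :
    ν {g | ¬ Good (j + 1) s g} ≤ C * ENNReal.ofReal (2 ^ (j + 1) * 4 ^ (s + 1) * b) := by
  have hset : {g | ¬ Good (j + 1) s g} = {g : Point (j + 1) → ℝ |
      ¬ ∀ z ∈ code s (j + 1), z ≠ 0 → 0 < ∑ x with z x ≠ 0, g x} := by
    ext g
    change ¬ Good (j + 1) s g ↔ _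
    rw [Good, if_pos hend]
    rfl
  have hb0 : 0 ≤ b := (pow_nonneg hz0 _).trans hb
  rw [hset]
  rcases eq_or_lt_of_le hs with rfl | hs1
  · refine (measure_not_ml_one_le h).trans ?_
    gcongr
    calc (2 : ENNReal) ^ (j + 2) * bhattacharyya μ ^ 2 ^ j
        ≤ ENNReal.ofReal 2 ^ (j + 2) * ENNReal.ofReal z ^ 2 ^ j := by
          rw [ENNReal.ofReal_ofNat]
          gcongr
      _ = ENNReal.ofReal (2 ^ (j + 2) * z ^ 2 ^ j) := by
          rw [ENNReal.ofReal_mul (by positivity), ENNReal.ofReal_pow zero_le_two,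
            ENNReal.ofReal_pow hz0]
      _ ≤ _ := by
          refine ENNReal.ofReal_le_ofReal (mul_le_mul ?_ (by simpa using hb) (by positivity)
            (by positivity))
          rw [pow_succ _ (j + 1)]
          gcongr
          norm_num
  · obtain rfl : s = j := by omega
    refine (measure_not_ml_parity_le h hs).trans ?_
    gcongr
    calc (4 : ENNReal) ^ (s + 1) * bhattacharyya μ ^ 2
        ≤ ENNReal.ofReal 4 ^ (s + 1) * ENNReal.ofReal z ^ 2 := by
          rw [ENNReal.ofReal_ofNat]
          gcongr
      _ = ENNReal.ofReal (4 ^ (s + 1) * z ^ 2) := by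
          rw [ENNReal.ofReal_mul (by positivity), ENNReal.ofReal_pow (by norm_num),
            ENNReal.ofReal_pow hz0]
      _ ≤ _ := by
          refine ENNReal.ofReal_le_ofReal (mul_le_mul ?_ (by simpa using hb) (by positivity)
            (by positivity))
          exact le_mul_of_one_le_left (by positivity) (one_le_pow₀ one_le_two)

lemma count_add_le {j s : ℕ} (C : ENNReal) (hs : 1 ≤ s) {b : ℝ} (hb : 0 ≤ b) :
    C * ENNReal.ofReal (2 ^ j * 4 ^ (s - 1 + 1) * b) + C * ENNReal.ofReal (2 ^ j * 4 ^ (s + 1) * b)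
      ≤ C * ENNReal.ofReal (2 ^ (j + 1) * 4 ^ (s + 1) * b) := by
  rw [← mul_add, ← ENNReal.ofReal_add (by positivity) (by positivity), Nat.sub_add_cancel hs,
    pow_succ 2 j, pow_succ 4 s]
  have : 0 ≤ (2 : ℝ) ^ j * 4 ^ s * b := by positivity
  exact mul_le_mul_right (ENNReal.ofReal_le_ofReal (by linarith)) C

lemma count_mul_mono (j s : ℕ) (C : ENNReal) {b c : ℝ} (h : b ≤ c) :
    C * ENNReal.ofReal (2 ^ j * 4 ^ (s + 1) * b) ≤ C * ENNReal.ofReal (2 ^ j * 4 ^ (s + 1) * c) :=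
  mul_le_mul_right (ENNReal.ofReal_le_ofReal (mul_le_mul_of_nonneg_left h (by positivity))) C

/-- On an erasure channel, a step to `u` followed by steps to `v` is no worse than the steps to `v`
followed by the step to `u`. The claim reduces to `2 ≤ (1 + z) ^ Q + (1 - z) ^ Q`, which is
Bernoulli's inequality used twice. -/
lemma one_sub_pow_erasure_le {z : ℝ} (h0 : 0 ≤ z) (h1 : z ≤ 1) (Q : ℕ) :
    1 - (1 - z ^ 2) ^ Q ≤ (1 - (1 - z) ^ Q) ^ 2 := by
  have e : (1 - z ^ 2) ^ Q = (1 - z) ^ Q * (1 + z) ^ Q := by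
    rw [← mul_pow]
    ring
  have hp := one_add_mul_le_pow (by linarith : (-2 : ℝ) ≤ z) Q
  have hm := one_add_mul_le_pow (by linarith : (-2 : ℝ) ≤ -z) Q
  rw [← sub_eq_add_neg] at hm
  have hq : 0 ≤ (1 - z) ^ Q := pow_nonneg (by linarith) Q
  rw [e]
  nlinarith

/-- The failure probability at a node is bounded as for an erasure channel with the same
Bhattacharyya parameter. -/
lemma measure_not_good_le_erasure {j : ℕ} : ∀ {s : ℕ} {C : ENNReal} {ν : Measure (Point j → ℝ)}
    {μ : Measure ℝ}, IsProbabilityMeasure μ → IsSymmetricLaw μ → HalfDominated C ν μ → 1 ≤ s →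
    s < j → ∀ {z : ℝ}, 0 ≤ z → z ≤ 1 → bhattacharyya μ ≤ ENNReal.ofReal z →
    ν {g | ¬ Good j s g} ≤ C * ENNReal.ofReal
      (2 ^ j * 4 ^ (s + 1) * (1 - (1 - z) ^ 2 ^ (s - 1)) ^ 2 ^ (j - s)) := by
  induction j with
  | zero =>
    intro s C ν μ _ _ _ _ h
    omega
  | succ j ih =>
    intro s C ν μ hμ hsym hdom hs hsj z h0 h1 hz
    have hE : ∀ {w : ℝ}, 0 ≤ w → w ≤ 1 → ∀ Q : ℕ, 0 ≤ 1 - (1 - w) ^ Q := fun h0 h1 Q =>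
      sub_nonneg.2 (pow_le_one₀ (by linarith) (by linarith))
    by_cases hend : s ≤ 1 ∨ j ≤ s
    · refine measure_not_good_end_le hdom hs (by omega) hend h0 hz
        (pow_le_pow_left₀ h0 ?_ _)
      have : (1 - z) ^ 2 ^ (s - 1) ≤ 1 - z :=
        pow_le_of_le_one (by linarith) (by linarith) (by positivity)
      linarith
    · obtain ⟨k, rfl⟩ : ∃ k, s = k + 2 := ⟨s - 2, by omega⟩
      have hadd : Measurable fun p : ℝ × ℝ => p.1 + p.2 := by fun_prop
      refine (measure_not_good_succ_le ν hend).trans ?_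
      have hV := ih (isProbabilityMeasure_pairLaw measurable_boxplus μ) hsym.pairLaw_boxplus
        (hdom.map_pairMap measurable_boxplus) (by omega : 1 ≤ k + 2 - 1) (by omega)
        (by nlinarith : 0 ≤ 2 * z - z ^ 2) (by nlinarith [sq_nonneg (1 - z)])
        (hsym.bhattacharyya_boxplus_le h0 h1 hz)
      have hU := ih (isProbabilityMeasure_pairLaw hadd μ) hsym.pairLaw_add
        (hdom.map_pairMap hadd) hs (by omega) (sq_nonneg z) (by nlinarith : z ^ 2 ≤ 1) (by
          rw [bhattacharyya_add, ENNReal.ofReal_pow h0]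
          gcongr)
      refine (add_le_add (hV.trans (count_mul_mono _ _ _ ?_))
        (hU.trans (count_mul_mono _ _ _ ?_))).trans
        (count_add_le C hs (pow_nonneg (hE h0 h1 _) _))
      -- For `v` the erasure recursion reproduces the bound exactly; only the step to `u` loses
      -- something.
      · rw [show j - (k + 2 - 1) = j + 1 - (k + 2) by omega,
          show 1 - (2 * z - z ^ 2) = (1 - z) ^ 2 by ring, ← pow_mul, ← pow_succ',
          show k + 2 - 1 - 1 + 1 = k + 2 - 1 by omega]
      · rw [show j + 1 - (k + 2) = j - (k + 2) + 1 by omega, pow_succ' 2 (j - (k + 2)), pow_mul]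
        exact pow_le_pow_left₀ (hE (sq_nonneg z) (by nlinarith) _) (one_sub_pow_erasure_le h0 h1 _) _

/-- The failure probability at a node in terms of the mean square of the spread. -/
lemma measure_not_good_le_exp {j : ℕ} : ∀ {s : ℕ} {C : ENNReal} {ν : Measure (Point j → ℝ)}
    {μ : Measure ℝ}, IsProbabilityMeasure μ → IsSymmetricLaw μ → HalfDominated C ν μ → 1 ≤ s →
    s < j → ∀ {x : ℝ}, 0 ≤ x → x ≤ 1 → ENNReal.ofReal x ≤ sqSpread μ →
    ν {g | ¬ Good j s g} ≤ C * ENNReal.ofReal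
      (2 ^ j * 4 ^ (s + 1) * Real.exp (-(2 ^ (j - s) / 2 * (x * (1 - x)) ^ 2 ^ (s - 1)))) := by
  induction j with
  | zero =>
    intro s C ν μ _ _ _ _ h
    omega
  | succ j ih =>
    intro s C ν μ hμ hsym hdom hs hsj x h0 h1 hx
    have hz := hsym.bhattacharyya_le_of_le_sqSpread h0 hx
    have hy0 : 0 ≤ x * (1 - x) := mul_nonneg h0 (by linarith)
    by_cases hend : s ≤ 1 ∨ j ≤ s
    · refine measure_not_good_end_le hdom hs (by omega) hend (by linarith) hz ?_
      have hle : (x * (1 - x)) ^ 2 ^ (s - 1) ≤ x :=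
        (pow_le_of_le_one hy0 (by nlinarith) (by positivity)).trans (by nlinarith)
      calc (1 - x / 2) ^ 2 ^ (j + 1 - s) ≤ Real.exp (-(x / 2)) ^ 2 ^ (j + 1 - s) :=
            pow_le_pow_left₀ (by linarith) (Real.one_sub_le_exp_neg _) _
        _ = Real.exp (-(2 ^ (j + 1 - s) / 2 * x)) := by
            rw [← Real.exp_nat_mul]
            push_cast
            ring_nf
        _ ≤ _ := by
            refine Real.exp_le_exp.2 (neg_le_neg ?_)
            gcongr
    · obtain ⟨k, rfl⟩ : ∃ k, s = k + 2 := ⟨s - 2, by omega⟩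
      have hadd : Measurable fun p : ℝ × ℝ => p.1 + p.2 := by fun_prop
      refine (measure_not_good_succ_le ν hend).trans ?_
      have hV := ih (isProbabilityMeasure_pairLaw measurable_boxplus μ) hsym.pairLaw_boxplus
        (hdom.map_pairMap measurable_boxplus) (by omega : 1 ≤ k + 2 - 1) (by omega)
        (sq_nonneg x) (by nlinarith : x ^ 2 ≤ 1) (by
          rw [sqSpread_boxplus, ENNReal.ofReal_pow h0]
          gcongr)
      have hz0 : 0 ≤ 1 - x / 2 := by linarith
      -- At the first step to `u` the spread is given up for the erasure bound with `z = (1 - x /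
      -- 2)²`. Since `1 - z = x - x² / 4`, the factor `1 - x` in the statement covers the loss.
      have hU := measure_not_good_le_erasure (isProbabilityMeasure_pairLaw hadd μ) hsym.pairLaw_add
        (hdom.map_pairMap hadd) hs (by omega) (sq_nonneg (1 - x / 2))
        (by nlinarith : (1 - x / 2) ^ 2 ≤ 1) (by
          rw [bhattacharyya_add, ENNReal.ofReal_pow hz0]
          gcongr)
      refine (add_le_add (hV.trans (count_mul_mono _ _ _ ?_))
        (hU.trans (count_mul_mono _ _ _ ?_))).trans
        (count_add_le C hs (Real.exp_pos _).le)
      · rw [show j - (k + 2 - 1) = j + 1 - (k + 2) by omega]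
        refine Real.exp_le_exp.2 (neg_le_neg ?_)
        gcongr
        rw [show k + 2 - 1 = k + 1 by omega, Nat.add_sub_cancel, pow_succ' 2 k, pow_mul]
        refine pow_le_pow_left₀ (sq_nonneg _) ?_ _
        rw [mul_pow]
        -- What remains is `(1 - x)² ≤ 1 - x²`.
        refine mul_le_mul_of_nonneg_left ?_ (sq_nonneg x)
        nlinarith
      · have hw : x * (1 - x) ≤ 1 - (1 - x / 2) ^ 2 := by nlinarith
        rw [show j + 1 - (k + 2) = j - (k + 2) + 1 by omega]
        calc (1 - (1 - (1 - x / 2) ^ 2) ^ 2 ^ (k + 2 - 1)) ^ 2 ^ (j - (k + 2))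
            ≤ Real.exp (-(x * (1 - x)) ^ 2 ^ (k + 2 - 1)) ^ 2 ^ (j - (k + 2)) := by
              refine pow_le_pow_left₀ (sub_nonneg.2 (pow_le_one₀ (by linarith)
                (by nlinarith))) ?_ _
              refine (sub_le_sub_left (pow_le_pow_left₀ hy0 hw _) 1).trans ?_
              exact Real.one_sub_le_exp_neg _
          _ = _ := by
              rw [← Real.exp_nat_mul]
              push_cast
              ring_nf

/-! ### The Gaussian channel. -/

open ProbabilityTheory

lemma isSymmetricLaw_gaussian {a : NNReal} (ha : a ≠ 0) :
    IsSymmetricLaw (gaussianReal a (2 * a)) := by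
  have hv : 2 * a ≠ 0 := by simpa using ha
  have ha' : (a : ℝ) ≠ 0 := by exact_mod_cast ha
  intro f hf
  have hd : ∀ g, gaussianPDF a (2 * a) (-g) = gaussianPDF a (2 * a) g * ratio g := by
    intro g
    rw [gaussianPDF, gaussianPDF, ratio, ← ENNReal.ofReal_mul (gaussianPDFReal_nonneg _ _ _)]
    congr 1
    have he : Real.exp (-(-g - (a : ℝ)) ^ 2 / (2 * (2 * a : NNReal))) =
        Real.exp (-(g - (a : ℝ)) ^ 2 / (2 * (2 * a : NNReal))) * Real.exp (-g) := by
      rw [← Real.exp_add]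
      congr 1
      push_cast
      field_simp
      ring
    simp only [gaussianPDFReal]
    rw [he, ← mul_assoc]
  have hm := measurable_gaussianPDF (a : ℝ) (2 * a)
  have hfn : Measurable fun g => f (-g) := hf.comp measurable_neg
  have hfr : Measurable fun g => f g * ratio g := hf.mul measurable_ratio
  rw [gaussianReal_of_var_ne_zero _ hv, lintegral_withDensity_eq_lintegral_mul _ hm hfn,
    lintegral_withDensity_eq_lintegral_mul _ hm hfr, ← lintegral_neg_eq_self]
  refine lintegral_congr fun g => ?_
  simp only [Pi.mul_apply, neg_neg, hd]
  ring

lemma bhattacharyya_gaussian (a : NNReal) :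
    bhattacharyya (gaussianReal a (2 * a)) = ENNReal.ofReal (Real.exp (-a / 4)) := by
  have hint : Integrable (fun g : ℝ => Real.exp (-g / 2)) (gaussianReal a (2 * a)) := by
    have := integrable_exp_mul_gaussianReal (μ := (a : ℝ)) (v := 2 * a) (-1 / 2)
    refine this.congr (ae_of_all _ fun g => ?_)
    ring_nf
  rw [bhattacharyya, ← ofReal_integral_eq_lintegral_ofReal hint
    (ae_of_all _ fun g => (Real.exp_pos _).le)]
  congr 1
  have := congrFun (mgf_id_gaussianReal (μ := (a : ℝ)) (v := 2 * a)) (-1 / 2)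
  rw [mgf] at this
  have e : ∀ g : ℝ, Real.exp (-1 / 2 * id g) = Real.exp (-g / 2) := fun g => by
    rw [id]
    ring_nf
  simp only [e] at this
  rw [this]
  push_cast
  ring_nf

/-- A symmetric law is a mixture of laws of binary symmetric channels. -/
lemma IsSymmetricLaw.lintegral_eq {μ : Measure ℝ} (h : IsSymmetricLaw μ) {f : ℝ → ENNReal}
    (hf : Measurable f) : ∫⁻ g, f g ∂μ =
      ∫⁻ g, f g * ENNReal.ofReal (1 / (1 + Real.exp (-g))) +
        f (-g) * ENNReal.ofReal (1 / (1 + Real.exp g)) ∂μ := by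
  have hF : Measurable fun g => f g * ENNReal.ofReal (1 / (1 + Real.exp (-g))) := by fun_prop
  have hs := h _ hF
  simp only [neg_neg] at hs
  rw [lintegral_add_left hF, hs, ← lintegral_add_left hF]
  refine lintegral_congr fun g => ?_
  have hg := Real.exp_pos (-g)
  rw [mul_assoc, ← mul_add, ratio, ← ENNReal.ofReal_mul (by positivity),
    ← ENNReal.ofReal_add (by positivity) (by positivity)]
  have : 1 / (1 + Real.exp (-g)) + 1 / (1 + Real.exp (-g)) * Real.exp (-g) = 1 := by
    field_simp
  rw [this, ENNReal.ofReal_one, mul_one]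

lemma lintegral_quadratic_gaussian (a : NNReal) (k : ℝ) :
    ∫⁻ g, ENNReal.ofReal ((1 - k * g) ^ 2) ∂gaussianReal a (2 * a) =
      ENNReal.ofReal ((1 - k * a) ^ 2 + k ^ 2 * (2 * a)) := by
  have h2 : MemLp id 2 (gaussianReal (a : ℝ) (2 * a)) := memLp_id_gaussianReal' 2 (by simp)
  have hsq : Integrable (fun g : ℝ => g ^ 2) (gaussianReal a (2 * a)) := h2.integrable_sq
  have hid : Integrable (fun g : ℝ => g) (gaussianReal a (2 * a)) := h2.integrable (by norm_num)
  have hvar := variance_eq_sub h2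
  rw [variance_id_gaussianReal] at hvar
  have hmean : ∫ g, g ∂gaussianReal a (2 * a) = a := integral_id_gaussianReal
  have hsq' : ∫ g, g ^ 2 ∂gaussianReal a (2 * a) = 2 * a + a ^ 2 := by
    simp only [Pi.pow_apply, id] at hvar
    rw [hmean] at hvar
    push_cast at hvar
    linarith
  have e : ∀ g : ℝ, (1 - k * g) ^ 2 = 1 - 2 * k * g + k ^ 2 * g ^ 2 := fun g => by ring
  have hlin : Integrable (fun g : ℝ => 1 - 2 * k * g) (gaussianReal a (2 * a)) :=
    (integrable_const _).sub (hid.const_mul _)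
  rw [← ofReal_integral_eq_lintegral_ofReal _ (ae_of_all _ fun g => sq_nonneg _)]
  · congr 1
    simp only [e]
    rw [integral_add hlin (hsq.const_mul _),
      integral_sub (integrable_const _) (hid.const_mul _), integral_const_mul, integral_const_mul,
      hmean, hsq']
    simp
    ring
  · simp only [e]
    exact hlin.add (hsq.const_mul _)

/-- The spread is the conditional mean of the sent sign given `g`, so one minus its mean square is
the least mean square error. It is at most the error of the linear estimate `k * g`, which is
smallest, namely `2 / (a + 2)`, at `k = 1 / (a + 2)`. -/
lemma le_sqSpread_gaussian {a : NNReal} (ha : a ≠ 0) :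
    ENNReal.ofReal (a / (a + 2)) ≤ sqSpread (gaussianReal a (2 * a)) := by
  have ha' : (0 : ℝ) < a := by exact_mod_cast pos_iff_ne_zero.2 ha
  set k : ℝ := 1 / (a + 2) with hk
  have hm : Measurable fun g => ENNReal.ofReal (spread g ^ 2) :=
    (measurable_spread.pow_const 2).ennreal_ofReal
  have hpt : ∀ g : ℝ, 1 ≤ ENNReal.ofReal (spread g ^ 2) +
      (ENNReal.ofReal ((1 - k * g) ^ 2) * ENNReal.ofReal (1 / (1 + Real.exp (-g))) +
        ENNReal.ofReal ((1 - k * -g) ^ 2) * ENNReal.ofReal (1 / (1 + Real.exp g))) := by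
    intro g
    have hg := Real.exp_pos (-g)
    have hg' := Real.exp_pos g
    rw [← ENNReal.ofReal_mul (sq_nonneg _), ← ENNReal.ofReal_mul (sq_nonneg _),
      ← ENNReal.ofReal_add (by positivity) (by positivity),
      ← ENNReal.ofReal_add (by positivity) (by positivity), ENNReal.one_le_ofReal]
    have e : Real.exp g = (Real.exp (-g))⁻¹ := by rw [Real.exp_neg, inv_inv]
    have : spread g ^ 2 + ((1 - k * g) ^ 2 * (1 / (1 + Real.exp (-g))) +
        (1 - k * -g) ^ 2 * (1 / (1 + Real.exp g))) = 1 + (spread g - k * g) ^ 2 := by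
      rw [e, spread_eq]
      field_simp
      ring
    rw [this]
    nlinarith [sq_nonneg (spread g - k * g)]
  have hint := lintegral_mono (μ := gaussianReal a (2 * a)) hpt
  rw [lintegral_add_left hm, ← (isSymmetricLaw_gaussian ha).lintegral_eq
    (f := fun g => ENNReal.ofReal ((1 - k * g) ^ 2)) (by fun_prop),
    lintegral_quadratic_gaussian, lintegral_const, measure_univ, mul_one] at hint
  have hval : (1 - k * a) ^ 2 + k ^ 2 * (2 * a) = 1 - a / (a + 2) := by
    rw [hk]
    field_simp
    ring
  rw [hval] at hint
  have h1 : ENNReal.ofReal (a / (a + 2)) + ENNReal.ofReal (1 - a / (a + 2)) = 1 := by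
    rw [← ENNReal.ofReal_add (by positivity), add_sub_cancel, ENNReal.ofReal_one]
    rw [sub_nonneg, div_le_one (by positivity)]
    linarith
  rw [← h1] at hint
  exact (ENNReal.add_le_add_iff_right ENNReal.ofReal_ne_top).1 hint

/-! ### Half of the coordinates of a sphere compared with Gaussian coordinates. -/

lemma measure_ext_of_Iic {μ ν : Measure ℝ} (hfin : ∀ a, μ (Set.Iic a) ≠ ⊤)
    (h : ∀ a, μ (Set.Iic a) = ν (Set.Iic a)) : μ = ν := by
  refine Measure.ext_of_Ioc' μ ν (fun a b _ => ?_) fun a b hab => ?_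
  · exact ne_top_of_le_ne_top (hfin b) (measure_mono Set.Ioc_subset_Iic_self)
  · have hs : Set.Iic a ⊆ Set.Iic b := Set.Iic_subset_Iic.2 hab.le
    rw [← Set.Iic_sdiff_Iic, measure_sdiff hs measurableSet_Iic.nullMeasurableSet (hfin a),
      measure_sdiff hs measurableSet_Iic.nullMeasurableSet (by rw [← h]; exact hfin a), h, h]

lemma volume_sum_sq_le {κ : Type*} [Fintype κ] {p : ℕ} (hp : 1 ≤ p)
    (hκ : Fintype.card κ = 2 * p) {q : ℝ} (hq : 0 ≤ q) :
    volume {b : κ → ℝ | ∑ i, b i ^ 2 ≤ q} =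
      ENNReal.ofReal (Real.pi ^ p / p.factorial * q ^ p) := by
  have : Nonempty κ := Fintype.card_pos_iff.1 (by omega)
  have hset : (WithLp.ofLp : EuclideanSpace ℝ κ → (κ → ℝ)) ⁻¹' {b : κ → ℝ | ∑ i, b i ^ 2 ≤ q} =
      Metric.closedBall 0 (√q) := by
    ext x
    rw [mem_closedBall_zero_iff, EuclideanSpace.norm_eq, Real.sqrt_le_sqrt_iff hq]
    simp
  rw [← (PiLp.volume_preserving_ofLp κ).measure_preimage
    (measurableSet_le (by fun_prop) measurable_const).nullMeasurableSet, hset,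
    EuclideanSpace.volume_closedBall, hκ, ← ENNReal.ofReal_pow (Real.sqrt_nonneg _),
    ← ENNReal.ofReal_mul (by positivity)]
  congr 1
  rw [pow_mul, pow_mul, Real.sq_sqrt hq, Real.sq_sqrt Real.pi_pos.le]
  push_cast
  rw [mul_div_cancel_left₀ _ (two_ne_zero' ℝ), Real.Gamma_nat_eq_factorial]
  ring

/-- The image of Lebesgue measure under the squared Euclidean norm. -/
lemma map_sum_sq {κ : Type*} [Fintype κ] {p : ℕ} (hp : 1 ≤ p) (hκ : Fintype.card κ = 2 * p) :
    (volume : Measure (κ → ℝ)).map (fun b => ∑ i, b i ^ 2) =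
      (volume.restrict (Set.Ioi 0)).withDensity fun q =>
        ENNReal.ofReal (Real.pi ^ p / (p - 1).factorial * q ^ (p - 1)) := by
  have hm : Measurable fun b : κ → ℝ => ∑ i, b i ^ 2 := by fun_prop
  have hval : ∀ q, (volume : Measure (κ → ℝ)).map (fun b => ∑ i, b i ^ 2) (Set.Iic q) =
      ENNReal.ofReal (Real.pi ^ p / p.factorial * (max q 0) ^ p) := by
    intro q
    rw [Measure.map_apply hm measurableSet_Iic]
    rcases le_or_gt 0 q with hq | hq
    · rw [max_eq_left hq]
      exact volume_sum_sq_le hp hκ hq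
    · have : (fun b : κ → ℝ => ∑ i, b i ^ 2) ⁻¹' Set.Iic q = ∅ := by
        refine Set.eq_empty_of_forall_notMem fun b hb => ?_
        have h0 : 0 ≤ ∑ i, b i ^ 2 := Finset.sum_nonneg fun i _ => sq_nonneg _
        exact absurd (le_trans h0 hb) (not_le.2 hq)
      rw [this, max_eq_right hq.le, zero_pow (by omega)]
      simp
  refine measure_ext_of_Iic (fun q => by rw [hval]; exact ENNReal.ofReal_ne_top) fun q => ?_
  rw [hval, withDensity_apply _ measurableSet_Iic, Measure.restrict_restrict measurableSet_Iic,
    Set.Iic_inter_Ioi]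
  rcases le_or_gt 0 q with hq | hq
  · rw [max_eq_left hq, ← ofReal_integral_eq_lintegral_ofReal, integral_const_mul,
      ← intervalIntegral.integral_of_le hq, integral_pow]
    · congr 1
      obtain ⟨k, rfl⟩ : ∃ k, p = k + 1 := ⟨p - 1, by omega⟩
      rw [Nat.add_sub_cancel, Nat.factorial_succ]
      have : (k.factorial : ℝ) ≠ 0 := by positivity
      push_cast
      simp
      field_simp
    · exact (Continuous.integrableOn_Icc (by fun_prop)).mono_set Set.Ioc_subset_Icc_self
    · refine (ae_restrict_mem measurableSet_Ioc).mono fun t ht => ?_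
      have := ht.1.le
      positivity
  · rw [max_eq_right hq.le, zero_pow (by omega), Set.Ioc_eq_empty (not_lt.2 hq.le)]
    simp

lemma lintegral_sum_sq {κ : Type*} [Fintype κ] {p : ℕ} (hp : 1 ≤ p)
    (hκ : Fintype.card κ = 2 * p) {φ : ℝ → ENNReal} (hφ : Measurable φ) :
    ∫⁻ b : κ → ℝ, φ (∑ i, b i ^ 2) =
      ∫⁻ q in Set.Ioi 0, ENNReal.ofReal (Real.pi ^ p / (p - 1).factorial * q ^ (p - 1)) * φ q := by
  rw [← lintegral_map hφ (by fun_prop), map_sum_sq hp hκ,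
    lintegral_withDensity_eq_lintegral_mul _ (by fun_prop) hφ]
  rfl

/-- Independent normal coordinates have the product density. -/
lemma pi_gaussianReal {κ : Type*} [Fintype κ] {v : NNReal} (hv : v ≠ 0) :
    Measure.pi (fun _ : κ => ProbabilityTheory.gaussianReal 0 v) =
      volume.withDensity fun a : κ → ℝ =>
        ENNReal.ofReal (∏ i, ProbabilityTheory.gaussianPDFReal 0 v (a i)) := by
  refine Measure.pi_eq fun s hs => ?_
  have hm : MeasurableSet (Set.univ.pi s) := MeasurableSet.univ_pi hs
  have hnn : ∀ x, 0 ≤ ProbabilityTheory.gaussianPDFReal 0 v x :=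
    ProbabilityTheory.gaussianPDFReal_nonneg 0 v
  have hint := ProbabilityTheory.integrable_gaussianPDFReal 0 v
  have hind : ∀ a : κ → ℝ, (Set.univ.pi s).indicator
      (fun a => ∏ i, ProbabilityTheory.gaussianPDFReal 0 v (a i)) a =
      ∏ i, (s i).indicator (ProbabilityTheory.gaussianPDFReal 0 v) (a i) := by
    classical
    intro a
    by_cases ha : a ∈ Set.univ.pi s
    · rw [Set.indicator_of_mem ha]
      exact Finset.prod_congr rfl fun i _ => (Set.indicator_of_mem (ha i trivial) _).symm
    · rw [Set.indicator_of_notMem ha]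
      obtain ⟨i, hi⟩ : ∃ i, a i ∉ s i := by simpa [Set.mem_pi] using ha
      exact (Finset.prod_eq_zero (Finset.mem_univ i) (Set.indicator_of_notMem hi _)).symm
  have hintp : Integrable (fun a : κ → ℝ => ∏ i, ProbabilityTheory.gaussianPDFReal 0 v (a i)) :=
    Integrable.fintype_prod fun _ => hint
  rw [withDensity_apply _ hm, ← ofReal_integral_eq_lintegral_ofReal hintp.integrableOn
    (ae_of_all _ fun a => Finset.prod_nonneg fun i _ => hnn _), ← integral_indicator hm]
  simp only [hind]
  rw [integral_fintype_prod_volume_eq_prod, ENNReal.ofReal_prod_of_nonneg]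
  · refine Finset.prod_congr rfl fun i _ => ?_
    rw [integral_indicator (hs i), ProbabilityTheory.gaussianReal_apply_eq_integral _ hv]
  · exact fun i _ => integral_nonneg fun x => Set.indicator_nonneg (fun _ _ => hnn _) _

lemma prod_gaussianPDFReal {κ : Type*} [Fintype κ] {p : ℕ} (hκ : Fintype.card κ = 2 * p)
    (v : NNReal) (a : κ → ℝ) :
    ∏ i, ProbabilityTheory.gaussianPDFReal 0 v (a i) =
      ((2 * Real.pi * v) ^ p)⁻¹ * Real.exp (-(∑ i, a i ^ 2) / (2 * v)) := by
  simp only [ProbabilityTheory.gaussianPDFReal, sub_zero]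
  rw [Finset.prod_mul_distrib, Finset.prod_const, Finset.card_univ, hκ, ← Real.exp_sum, inv_pow,
    pow_mul, Real.sq_sqrt (by positivity), ← Finset.sum_div, Finset.sum_neg_distrib]

/-- This compares the spherical marginal density with the Gaussian one. The inequality `2 * (1 - x)
≤ exp (1 - 2 * x)` is tangent at `x = 1/2`, the typical share of the squared norm in half of the
coordinates. -/
lemma pow_le_exp_aux {p : ℕ} (hp : 1 ≤ p) {x : ℝ} (hx : x ≤ 1) :
    (1 - x) ^ (p - 1) ≤ 2 * Real.exp (p + 1) / 2 ^ p * Real.exp (-(2 * p * x)) := by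
  obtain ⟨k, rfl⟩ : ∃ k, p = k + 1 := ⟨p - 1, by omega⟩
  have h1 : 2 * (1 - x) ≤ Real.exp (1 - 2 * x) := by
    have := Real.add_one_le_exp (1 - 2 * x)
    linarith
  have h2 : (2 * (1 - x)) ^ k ≤ Real.exp (1 - 2 * x) ^ k :=
    pow_le_pow_left₀ (by linarith) h1 k
  rw [mul_pow, ← Real.exp_nat_mul] at h2
  have h3 : Real.exp (k * (1 - 2 * x)) ≤
      Real.exp ((k + 1 : ℕ) + 1) * Real.exp (-(2 * (k + 1 : ℕ) * x)) := by
    rw [← Real.exp_add]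
    refine Real.exp_le_exp.2 ?_
    push_cast
    linarith
  rw [Nat.add_sub_cancel, pow_succ]
  have h4 : (0 : ℝ) < 2 ^ k := by positivity
  rw [div_mul_eq_mul_div, le_div_iff₀ (by positivity)]
  linarith

/-- The Stirling sequence decreases, so its value at `2 * p` is at most that at `p`. -/
lemma factorial_two_mul_le {p : ℕ} (hp : 1 ≤ p) :
    ((2 * p).factorial : ℝ) * Real.exp p ≤ √2 * (p.factorial * 4 ^ p * p ^ p) := by
  have h := Stirling.stirlingSeq'_antitone (show p - 1 ≤ 2 * p - 1 by omega)
  simp only [Function.comp_apply, Nat.succ_eq_add_one] at h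
  rw [Nat.sub_add_cancel hp, Nat.sub_add_cancel (by omega : 1 ≤ 2 * p), Stirling.stirlingSeq,
    Stirling.stirlingSeq] at h
  have hp0 : (0 : ℝ) < p := by exact_mod_cast hp
  rw [div_le_div_iff₀ (by positivity) (by positivity)] at h
  have hs : √(2 * ((2 * p : ℕ) : ℝ)) = √2 * √(2 * p) := by
    rw [← Real.sqrt_mul zero_le_two]
    push_cast
    ring_nf
  rw [hs, div_pow, div_pow, ← Real.exp_nat_mul, ← Real.exp_nat_mul, mul_one, mul_one] at h
  have he : Real.exp ((2 * p : ℕ) : ℝ) = Real.exp p * Real.exp p := by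
    rw [← Real.exp_add]
    push_cast
    ring_nf
  have hpp : ((2 * p : ℕ) : ℝ) ^ (2 * p) = 4 ^ p * (p : ℝ) ^ p * (p : ℝ) ^ p := by
    push_cast
    rw [mul_pow, pow_mul, pow_mul]
    norm_num
    ring
  rw [he, hpp] at h
  have hE := Real.exp_pos p
  have hS : 0 < √(2 * (p : ℝ)) := Real.sqrt_pos.2 (by positivity)
  have hP : (0 : ℝ) < (p : ℝ) ^ p := by positivity
  have e1 : ((2 * p).factorial : ℝ) * (√(2 * (p : ℝ)) * ((p : ℝ) ^ p / Real.exp p)) =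
      ((2 * p).factorial * Real.exp p) * (√(2 * (p : ℝ)) * (p : ℝ) ^ p /
        (Real.exp p * Real.exp p)) := by
    field_simp
  have e2 : (p.factorial : ℝ) * (√2 * √(2 * p) * (4 ^ p * (p : ℝ) ^ p * (p : ℝ) ^ p /
        (Real.exp p * Real.exp p))) = √2 * (p.factorial * 4 ^ p * p ^ p) *
        (√(2 * (p : ℝ)) * (p : ℝ) ^ p / (Real.exp p * Real.exp p)) := by
    field_simp
  rw [e1, e2] at h
  exact le_of_mul_le_mul_right h (by positivity)

/-- The part of a cone over a set of directions that is determined by half of the coordinates,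
compared with independent normal coordinates. -/
lemma volume_cone_le {κ κ' : Type*} [Fintype κ] [Fintype κ'] {p : ℕ} (hp : 1 ≤ p)
    (hκ : Fintype.card κ = 2 * p) (hκ' : Fintype.card κ' = 2 * p) {ρ : ℝ} (hρ : 0 < ρ)
    {v : NNReal} (hv : (v : ℝ) = ρ ^ 2 / (4 * p)) {A : Set (κ → ℝ)} (hA : MeasurableSet A) :
    ((volume : Measure (κ → ℝ)).prod (volume : Measure (κ' → ℝ)))
      {x | ∑ i, x.1 i ^ 2 + ∑ i, x.2 i ^ 2 < 1 ∧
        (ρ / √(∑ i, x.1 i ^ 2 + ∑ i, x.2 i ^ 2)) • x.1 ∈ A} ≤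
      ENNReal.ofReal (Real.pi ^ (2 * p) * Real.exp (p + 1) / (p.factorial * 4 ^ p * p ^ p)) *
        Measure.pi (fun _ : κ => ProbabilityTheory.gaussianReal 0 v) A := by
  have hp0 : (0 : ℝ) < p := by exact_mod_cast hp
  have hv0 : (0 : ℝ) < v := by rw [hv]; positivity
  have hvne : v ≠ 0 := by
    rintro rfl
    simp at hv0
  set K : ℝ := Real.pi ^ p / (p - 1).factorial with hK
  have hK0 : 0 < K := by positivity
  set D : Set (ℝ × (κ → ℝ)) :=
    {y | ∑ i, y.2 i ^ 2 < y.1 ∧ y.1 < 1 ∧ (ρ / √y.1) • y.2 ∈ A} with hD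
  have hDm : MeasurableSet D := by
    refine (measurableSet_lt (by fun_prop) measurable_fst).inter
      ((measurableSet_lt measurable_fst measurable_const).inter ?_)
    have : Measurable fun y : ℝ × (κ → ℝ) => (ρ / √y.1) • y.2 := by fun_prop
    exact this hA
  set H : ℝ × (κ → ℝ) → ENNReal :=
    D.indicator fun y => ENNReal.ofReal (K * (y.1 - ∑ i, y.2 i ^ 2) ^ (p - 1)) with hH
  have hHm : Measurable H := by
    refine Measurable.indicator ?_ hDm
    fun_prop
  have hSm : MeasurableSet {x : (κ → ℝ) × (κ' → ℝ) | ∑ i, x.1 i ^ 2 + ∑ i, x.2 i ^ 2 < 1 ∧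
        (ρ / √(∑ i, x.1 i ^ 2 + ∑ i, x.2 i ^ 2)) • x.1 ∈ A} := by
    have hs : Measurable fun x : (κ → ℝ) × (κ' → ℝ) => ∑ i, x.1 i ^ 2 + ∑ i, x.2 i ^ 2 := by
      fun_prop
    refine (measurableSet_lt hs measurable_const).inter ?_
    have : Measurable fun x : (κ → ℝ) × (κ' → ℝ) =>
      (ρ / √(∑ i, x.1 i ^ 2 + ∑ i, x.2 i ^ 2)) • x.1 := by fun_prop
    exact this hA
  -- The variable `b` enters only through its squared norm, of density `K * q ^ (p - 1)`. It is
  -- replaced by `r`, the squared norm of the whole vector.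
  have hslice : ∀ a : κ → ℝ, volume {b : κ' → ℝ | ∑ i, a i ^ 2 + ∑ i, b i ^ 2 < 1 ∧
      (ρ / √(∑ i, a i ^ 2 + ∑ i, b i ^ 2)) • a ∈ A} = ∫⁻ r, H (r, a) := by
    intro a
    set s := ∑ i, a i ^ 2 with hs
    set Q : Set ℝ := {q | s + q < 1 ∧ (ρ / √(s + q)) • a ∈ A} with hQ
    have hQm : MeasurableSet Q := by
      refine (measurableSet_lt (measurable_const_add s) measurable_const).inter ?_
      have : Measurable fun q : ℝ => (ρ / √(s + q)) • a := by fun_prop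
      exact this hA
    have hmap : Measurable fun b : κ' → ℝ => ∑ i, b i ^ 2 := by fun_prop
    calc volume {b : κ' → ℝ | s + ∑ i, b i ^ 2 < 1 ∧ (ρ / √(s + ∑ i, b i ^ 2)) • a ∈ A}
        = ∫⁻ b : κ' → ℝ, Q.indicator 1 (∑ i, b i ^ 2) :=
          (lintegral_indicator_one (hmap hQm)).symm
      _ = ∫⁻ q in Set.Ioi 0, ENNReal.ofReal (K * q ^ (p - 1)) * Q.indicator 1 q :=
          lintegral_sum_sq hp hκ' (measurable_one.indicator hQm)
      _ = ∫⁻ q, (Set.Ioi 0).indicator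
            (fun q => ENNReal.ofReal (K * q ^ (p - 1)) * Q.indicator 1 q) q :=
          (lintegral_indicator measurableSet_Ioi _).symm
      _ = ∫⁻ r, (Set.Ioi 0).indicator
            (fun q => ENNReal.ofReal (K * q ^ (p - 1)) * Q.indicator 1 q) (r - s) :=
          (lintegral_sub_right_eq_self _ s).symm
      _ = ∫⁻ r, H (r, a) := by
          refine lintegral_congr fun r => ?_
          have e1 : r - s ∈ Q ↔ r < 1 ∧ (ρ / √r) • a ∈ A := by
            change s + (r - s) < 1 ∧ (ρ / √(s + (r - s))) • a ∈ A ↔ _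
            rw [add_sub_cancel]
          have e2 : (r, a) ∈ D ↔ s < r ∧ r - s ∈ Q := by
            rw [e1]
            rfl
          by_cases h1 : s < r
          · rw [Set.indicator_of_mem (Set.mem_Ioi.2 (sub_pos.2 h1))]
            by_cases h2 : r - s ∈ Q
            · rw [hH, Set.indicator_of_mem (e2.2 ⟨h1, h2⟩), Set.indicator_of_mem h2, Pi.one_apply,
                mul_one]
            · rw [hH, Set.indicator_of_notMem fun h => h2 (e2.1 h).2, Set.indicator_of_notMem h2,
                mul_zero]
          · rw [hH, Set.indicator_of_notMem fun h => h1 (e2.1 h).1,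
              Set.indicator_of_notMem fun h => h1 (sub_pos.1 (Set.mem_Ioi.1 h))]
  have hpdf : ∀ a : κ → ℝ, ∑ i, a i ^ 2 < ρ ^ 2 →
      (1 - (∑ i, a i ^ 2) / ρ ^ 2) ^ (p - 1) ≤
        2 * Real.exp (p + 1) / 2 ^ p * (2 * Real.pi * v) ^ p *
          ∏ i, ProbabilityTheory.gaussianPDFReal 0 v (a i) := by
    intro a ha
    refine (pow_le_exp_aux hp ((div_le_one (by positivity)).2 ha.le)).trans (le_of_eq ?_)
    rw [prod_gaussianPDFReal hκ, mul_assoc _ ((2 * Real.pi * v) ^ p) _, mul_inv_cancel_left₀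
      (by positivity), hv]
    congr 2
    field_simp
    ring
  set M : ℝ := 2 * Real.exp (p + 1) / 2 ^ p * (2 * Real.pi * v) ^ p with hM
  have hM0 : 0 < M := by positivity
  set γ := Measure.pi (fun _ : κ => ProbabilityTheory.gaussianReal 0 v) with hγ
  have hinner : ∀ r, ∫⁻ a, H (r, a) ≤ (Set.Ioo 0 1).indicator
      (fun r => ENNReal.ofReal (K * M / ρ ^ (2 * p) * r ^ (2 * p - 1)) * γ A) r := by
    intro r
    by_cases hr : r ∈ Set.Ioo (0 : ℝ) 1
    · rw [Set.indicator_of_mem hr]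
      have hr0 := hr.1
      set c := √r / ρ with hc
      have hc0 : 0 < c := by positivity
      have hcr : ρ / √r = c⁻¹ := by rw [hc, inv_div]
      have hc2 : c ^ 2 = r / ρ ^ 2 := by rw [hc, div_pow, Real.sq_sqrt hr0.le]
      have hHr : Measurable fun a => H (r, a) := hHm.comp measurable_prodMk_left
      have hmap := Measure.map_addHaar_smul (volume : Measure (κ → ℝ)) (inv_ne_zero hc0.ne')
      -- For fixed `r` the substitution `a ↦ c • a` turns the condition on the direction into `a ∈
      -- A`, free of `r`.
      have hscale : ∫⁻ a, H (r, a) = ENNReal.ofReal (c ^ (2 * p)) * ∫⁻ a, H (r, c • a) := by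
        have h1 : ∫⁻ a, H (r, a) = ∫⁻ a, H (r, c • a)
            ∂((volume : Measure (κ → ℝ)).map fun x => c⁻¹ • x) := by
          have hHc : Measurable fun a => H (r, c • a) := hHr.comp (measurable_const_smul c)
          rw [lintegral_map hHc (measurable_const_smul c⁻¹)]
          simp only [smul_inv_smul₀ hc0.ne']
        rw [h1, hmap, lintegral_smul_measure, Module.finrank_fintype_fun_eq_card, hκ, inv_pow,
          inv_inv, abs_of_pos (by positivity), smul_eq_mul]
      rw [hscale]
      have hpt : ∀ a, H (r, c • a) ≤ A.indicator (fun a => ENNReal.ofReal (K * r ^ (p - 1) * M) *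
          ENNReal.ofReal (∏ i, ProbabilityTheory.gaussianPDFReal 0 v (a i))) a := by
        intro a
        by_cases hmem : (r, c • a) ∈ D
        · have hsum : ∑ i, (c • a) i ^ 2 = r * ((∑ i, a i ^ 2) / ρ ^ 2) := by
            simp only [Pi.smul_apply, smul_eq_mul, mul_pow]
            rw [← Finset.mul_sum, hc2]
            ring
          have h1 := hmem.1
          have h3 := hmem.2.2
          simp only at h1 h3
          rw [hcr, inv_smul_smul₀ hc0.ne'] at h3
          rw [hsum] at h1
          have hlt : ∑ i, a i ^ 2 < ρ ^ 2 := by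
            rw [← div_lt_one (by positivity)]
            exact lt_of_mul_lt_mul_left (by simpa using h1) hr0.le
          rw [hH, Set.indicator_of_mem hmem, Set.indicator_of_mem h3,
            ← ENNReal.ofReal_mul (by positivity)]
          refine ENNReal.ofReal_le_ofReal ?_
          simp only
          rw [hsum, show r - r * ((∑ i, a i ^ 2) / ρ ^ 2) = r * (1 - (∑ i, a i ^ 2) / ρ ^ 2) by ring,
            mul_pow, ← mul_assoc, mul_assoc _ M]
          exact mul_le_mul_of_nonneg_left (hpdf a hlt) (by positivity)
        · rw [hH, Set.indicator_of_notMem hmem]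
          exact zero_le
      refine (mul_le_mul_right (lintegral_mono hpt) _).trans (le_of_eq ?_)
      have hpm : Measurable fun a : κ → ℝ =>
          ENNReal.ofReal (∏ i, ProbabilityTheory.gaussianPDFReal 0 v (a i)) := by
        refine Measurable.ennreal_ofReal (Finset.measurable_prod _ fun i _ => ?_)
        exact (ProbabilityTheory.measurable_gaussianPDFReal 0 v).comp (measurable_pi_apply i)
      rw [lintegral_indicator hA, lintegral_const_mul _ hpm, ← withDensity_apply _ hA,
        ← pi_gaussianReal hvne, ← mul_assoc, ← ENNReal.ofReal_mul (by positivity)]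
      congr 2
      rw [pow_mul, hc2, div_pow, ← pow_mul, show 2 * p - 1 = p + (p - 1) by omega, pow_add]
      field_simp
    · rw [Set.indicator_of_notMem hr]
      refine le_of_eq ((lintegral_congr fun a => ?_).trans lintegral_zero)
      refine Set.indicator_of_notMem (fun hmem => hr ?_) _
      have h0 : 0 ≤ ∑ i, a i ^ 2 := Finset.sum_nonneg fun i _ => sq_nonneg _
      exact ⟨h0.trans_lt hmem.1, hmem.2.1⟩
  rw [Measure.prod_apply hSm]
  calc ∫⁻ a, volume (Prod.mk a ⁻¹' {x : (κ → ℝ) × (κ' → ℝ) |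
        ∑ i, x.1 i ^ 2 + ∑ i, x.2 i ^ 2 < 1 ∧
        (ρ / √(∑ i, x.1 i ^ 2 + ∑ i, x.2 i ^ 2)) • x.1 ∈ A})
      = ∫⁻ a, ∫⁻ r, H (r, a) := lintegral_congr hslice
    _ = ∫⁻ r, ∫⁻ a, H (r, a) :=
        lintegral_lintegral_swap (f := fun a r => H (r, a)) (hHm.comp measurable_swap).aemeasurable
    _ ≤ ∫⁻ r, (Set.Ioo 0 1).indicator
          (fun r => ENNReal.ofReal (K * M / ρ ^ (2 * p) * r ^ (2 * p - 1)) * γ A) r :=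
        lintegral_mono hinner
    _ = ENNReal.ofReal (K * M / ρ ^ (2 * p) / (2 * p)) * γ A := by
        rw [lintegral_indicator measurableSet_Ioo, lintegral_mul_const _ (by fun_prop),
          restrict_Ioo_eq_restrict_Ioc, ← ofReal_integral_eq_lintegral_ofReal, integral_const_mul,
          ← intervalIntegral.integral_of_le zero_le_one, integral_pow]
        · congr 2
          rw [show 2 * p - 1 + 1 = 2 * p by omega, one_pow, zero_pow (by omega), sub_zero,
            Nat.cast_sub (by omega : 1 ≤ 2 * p)]
          push_cast
          rw [sub_add_cancel]
          ring
        · exact (Continuous.integrableOn_Icc (by fun_prop)).mono_set Set.Ioc_subset_Icc_self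
        · refine (ae_restrict_mem measurableSet_Ioc).mono fun t ht => ?_
          have := ht.1.le
          positivity
    _ = _ := by
        congr 2
        have hf : (p.factorial : ℝ) = p * (p - 1).factorial := by
          exact_mod_cast (Nat.mul_factorial_pred (by omega : p ≠ 0)).symm
        rw [hK, hM, hv, hf, show 2 * Real.pi * (ρ ^ 2 / (4 * p)) = Real.pi * ρ ^ 2 / (2 * p) by
          field_simp; ring, div_pow, mul_pow, mul_pow, pow_mul ρ, pow_mul' Real.pi 2 p, sq (Real.pi ^ p),
          show (4 : ℝ) = 2 * 2 by norm_num, mul_pow]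
        field_simp

lemma volume_ball_eq {ι : Type*} [Fintype ι] {p : ℕ} (hp : 1 ≤ p)
    (hι : Fintype.card ι = 4 * p) :
    volume (Metric.ball (0 : EuclideanSpace ℝ ι) 1) =
      ENNReal.ofReal (Real.pi ^ (2 * p) / (2 * p).factorial) := by
  have : Nonempty ι := Fintype.card_pos_iff.1 (by omega)
  rw [EuclideanSpace.volume_ball, hι, ENNReal.ofReal_one, one_pow, one_mul,
    show 4 * p = 2 * (2 * p) by ring, pow_mul, Real.sq_sqrt Real.pi_pos.le]
  push_cast
  rw [mul_div_cancel_left₀ _ (two_ne_zero' ℝ)]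
  have := Real.Gamma_nat_eq_factorial (2 * p)
  push_cast at this
  rw [this]

/-- The constant 4 arises here: relative to the volume of the ball, the factor is at most `√2 * exp
1 < 4`. -/
lemma cone_const_le {p : ℕ} (hp : 1 ≤ p) :
    Real.pi ^ (2 * p) * Real.exp (p + 1) / (p.factorial * 4 ^ p * p ^ p) ≤
      4 * (Real.pi ^ (2 * p) / (2 * p).factorial) := by
  have h := factorial_two_mul_le hp
  have hp0 : (0 : ℝ) < p := by exact_mod_cast hp
  have hs : √2 ≤ 1.42 := Real.sqrt_le_iff.2 (by norm_num)
  have he : Real.exp 1 ≤ 2.72 := Real.exp_one_lt_d9.le.trans (by norm_num)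
  have hc : √2 * Real.exp 1 ≤ 4 := by
    calc √2 * Real.exp 1 ≤ 1.42 * 2.72 := by gcongr
      _ ≤ 4 := by norm_num
  rw [Real.exp_add, ← mul_div_assoc, div_le_div_iff₀ (by positivity) (by positivity)]
  have hD : (0 : ℝ) < p.factorial * 4 ^ p * p ^ p := by positivity
  calc Real.pi ^ (2 * p) * (Real.exp p * Real.exp 1) * (2 * p).factorial
      = Real.pi ^ (2 * p) * Real.exp 1 * ((2 * p).factorial * Real.exp p) := by ring
    _ ≤ Real.pi ^ (2 * p) * Real.exp 1 * (√2 * (p.factorial * 4 ^ p * p ^ p)) := by gcongr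
    _ = Real.pi ^ (2 * p) * (p.factorial * 4 ^ p * p ^ p) * (√2 * Real.exp 1) := by ring
    _ ≤ Real.pi ^ (2 * p) * (p.factorial * 4 ^ p * p ^ p) * 4 := by gcongr
    _ = _ := by ring

open scoped Pointwise in
/-- On a sphere, events that involve at most half of the coordinates are at most four times as
likely as for independent normal coordinates. -/
lemma toSphere_le {ι : Type*} [Fintype ι] {p : ℕ} (hp : 1 ≤ p)
    (hι : Fintype.card ι = 4 * p) {ρ : ℝ} (hρ : 0 < ρ) {v : NNReal}
    (hv : (v : ℝ) = ρ ^ 2 / (4 * p)) {T : Finset ι} (hT : 2 * T.card ≤ 4 * p)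
    {A : Set (ι → ℝ)} (hA : MeasurableSet A) (hdep : DependsOn (· ∈ A) (T : Set ι)) :
    (volume : Measure (EuclideanSpace ℝ ι)).toSphere
        {x | WithLp.ofLp (ρ • (x : EuclideanSpace ℝ ι)) ∈ A} ≤
      4 * Measure.pi (fun _ : ι => ProbabilityTheory.gaussianReal 0 v) A *
        (volume : Measure (EuclideanSpace ℝ ι)).toSphere Set.univ := by
  classical
  -- Enlarging `T` to exactly half of the coordinates makes both blocks of even dimension `2 * p`,
  -- so that the ball volumes involve factorials only.
  obtain ⟨T', hTT', hcard⟩ := Finset.exists_superset_card_eq (s := T) (n := 2 * p) (by omega)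
    (by omega)
  replace hdep : DependsOn (· ∈ A) (T' : Set ι) := hdep.mono (by exact_mod_cast hTT')
  obtain ⟨P, hP⟩ : ∃ P : ι → Prop, ∀ i, i ∈ T' ↔ P i := ⟨_, fun _ => Iff.rfl⟩
  have hκ : Fintype.card {i // P i} = 2 * p := by rw [Fintype.card_of_subtype T' hP, hcard]
  have hκ' : Fintype.card {i // ¬ P i} = 2 * p := by
    rw [Fintype.card_subtype_compl, hκ, hι]
    omega
  set ext : ({i // P i} → ℝ) → ι → ℝ := fun a i => if h : P i then a ⟨i, h⟩ else 0 with hext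
  have hextm : Measurable ext := by
    refine measurable_pi_lambda _ fun i => ?_
    by_cases h : P i
    · simpa [hext, h] using measurable_pi_apply _
    · simp [hext, h]
  set A' := ext ⁻¹' A with hA'
  have hA'm : MeasurableSet A' := hextm hA
  have hiff : ∀ x : ι → ℝ, x ∈ A ↔ (fun i : {i // P i} => x i) ∈ A' := by
    intro x
    refine iff_of_eq (hdep fun i hi => ?_)
    have hi' : P i := (hP i).1 hi
    simp [hext, hi']
  have hgauss : Measure.pi (fun _ : {i // P i} => ProbabilityTheory.gaussianReal 0 v) A' =
      Measure.pi (fun _ : ι => ProbabilityTheory.gaussianReal 0 v) A := by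
    have h := measurePreserving_piEquivPiSubtypeProd
      (fun _ : ι => ProbabilityTheory.gaussianReal 0 v) P
    have hpre : A = MeasurableEquiv.piEquivPiSubtypeProd (fun _ : ι => ℝ) P ⁻¹'
        (A' ×ˢ Set.univ) := by
      ext x
      rw [hiff]
      simp [MeasurableEquiv.piEquivPiSubtypeProd, Equiv.piEquivPiSubtypeProd]
    conv_rhs => rw [hpre]
    rw [h.measure_preimage (hA'm.prod MeasurableSet.univ).nullMeasurableSet, Measure.prod_prod,
      measure_univ, mul_one]
  have hsplit : ∀ x : ι → ℝ, ∑ i, x i ^ 2 =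
      ∑ i : {i // P i}, x i ^ 2 + ∑ i : {i // ¬ P i}, x i ^ 2 := fun x =>
    (Fintype.sum_subtype_add_sum_subtype P fun i => x i ^ 2).symm
  set S : Set (({i // P i} → ℝ) × ({i // ¬ P i} → ℝ)) :=
    {x | ∑ i, x.1 i ^ 2 + ∑ i, x.2 i ^ 2 < 1 ∧
      (ρ / √(∑ i, x.1 i ^ 2 + ∑ i, x.2 i ^ 2)) • x.1 ∈ A'} with hS
  have hSm : MeasurableSet S := by
    have hs : Measurable fun x : ({i // P i} → ℝ) × ({i // ¬ P i} → ℝ) =>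
        ∑ i, x.1 i ^ 2 + ∑ i, x.2 i ^ 2 := by fun_prop
    refine (measurableSet_lt hs measurable_const).inter ?_
    have : Measurable fun x : ({i // P i} → ℝ) × ({i // ¬ P i} → ℝ) =>
      (ρ / √(∑ i, x.1 i ^ 2 + ∑ i, x.2 i ^ 2)) • x.1 := by fun_prop
    exact this hA'm
  have hpi := volume_preserving_piEquivPiSubtypeProd (fun _ : ι => ℝ) P
  have hpres := hpi.comp (PiLp.volume_preserving_ofLp ι)
  have hsm : MeasurableSet {x : Metric.sphere (0 : EuclideanSpace ℝ ι) 1 |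
      WithLp.ofLp (ρ • (x : EuclideanSpace ℝ ι)) ∈ A} := by
    have : Measurable fun x : Metric.sphere (0 : EuclideanSpace ℝ ι) 1 =>
        WithLp.ofLp (ρ • (x : EuclideanSpace ℝ ι)) :=
      (PiLp.volume_preserving_ofLp ι).measurable.comp (measurable_subtype_coe.const_smul ρ)
    exact this hA
  have hcone : Set.Ioo (0 : ℝ) 1 • ((↑) '' {x : Metric.sphere (0 : EuclideanSpace ℝ ι) 1 |
      WithLp.ofLp (ρ • (x : EuclideanSpace ℝ ι)) ∈ A} : Set (EuclideanSpace ℝ ι)) ⊆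
      (MeasurableEquiv.piEquivPiSubtypeProd (fun _ : ι => ℝ) P ∘ WithLp.ofLp) ⁻¹' S := by
    rintro _ ⟨t, ht, _, ⟨x, hx, rfl⟩, rfl⟩
    have hnorm : ∑ i, (t • (x : EuclideanSpace ℝ ι)) i ^ 2 = t ^ 2 := by
      have h1 := EuclideanSpace.norm_sq_eq (t • (x : EuclideanSpace ℝ ι))
      rw [norm_smul, norm_eq_of_mem_sphere, mul_one, Real.norm_eq_abs, sq_abs] at h1
      simpa only [Real.norm_eq_abs, sq_abs] using h1.symm
    have hsum := (hsplit (WithLp.ofLp (t • (x : EuclideanSpace ℝ ι)))).symm.trans hnorm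
    change _ < _ ∧ _ ∈ A'
    change (∑ i : {i // P i}, (t • (x : EuclideanSpace ℝ ι)) i ^ 2 +
      ∑ i : {i // ¬ P i}, (t • (x : EuclideanSpace ℝ ι)) i ^ 2) < 1 ∧
      (ρ / √(∑ i : {i // P i}, (t • (x : EuclideanSpace ℝ ι)) i ^ 2 +
        ∑ i : {i // ¬ P i}, (t • (x : EuclideanSpace ℝ ι)) i ^ 2)) •
        (fun i : {i // P i} => (t • (x : EuclideanSpace ℝ ι)) i) ∈ A'
    rw [hsum, Real.sqrt_sq ht.1.le]
    refine ⟨by nlinarith [ht.1, ht.2], ?_⟩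
    have hx' := (hiff _).1 hx
    convert hx' using 1
    funext i
    have := ht.1.ne'
    simp
    field_simp
  have hvol : (volume : Measure (EuclideanSpace ℝ ι)) (Set.Ioo (0 : ℝ) 1 • ((↑) ''
      {x : Metric.sphere (0 : EuclideanSpace ℝ ι) 1 |
        WithLp.ofLp (ρ • (x : EuclideanSpace ℝ ι)) ∈ A} : Set (EuclideanSpace ℝ ι))) ≤
      4 * Measure.pi (fun _ : ι => ProbabilityTheory.gaussianReal 0 v) A *
        volume (Metric.ball (0 : EuclideanSpace ℝ ι) 1) := by
    refine (measure_mono hcone).trans ?_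
    rw [hpres.measure_preimage hSm.nullMeasurableSet]
    refine (volume_cone_le hp hκ hκ' hρ hv hA'm).trans ?_
    rw [hgauss, volume_ball_eq hp hι]
    refine le_trans (mul_le_mul_left ?_ _) (le_of_eq (mul_right_comm _ _ _))
    rw [show (4 : ENNReal) = ENNReal.ofReal 4 by simp, ← ENNReal.ofReal_mul (by norm_num)]
    exact ENNReal.ofReal_le_ofReal (cone_const_le hp)
  rw [Measure.toSphere_apply' _ hsm, Measure.toSphere_apply_univ, mul_left_comm]
  exact mul_le_mul_right hvol _

/-! ### From error patterns on the sphere to failure bounds. -/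

/-- The law of the likelihoods of the transmitted symbols, for errors on a sphere. -/
noncomputable def sphereLaw (m : ℕ) (ρ : ℝ) (c : Word m) : Measure (Point m → ℝ) :=
  (((volume : Measure (ErrorPattern m)).toSphere Set.univ)⁻¹ •
    (volume : Measure (ErrorPattern m)).toSphere).map fun (x : Metric.sphere (0 : ErrorPattern m) 1) y =>
      modulate (c y) * likelihood (ρ ^ 2 / len m) (modulate (c y) + ρ * (x : ErrorPattern m) y)

lemma modulate_mul_self (b : ZMod 2) : modulate b * modulate b = 1 := by
  unfold modulate
  split_ifs <;> norm_num

lemma measurable_sphereLaw_map (m : ℕ) (ρ : ℝ) (c : Word m) : Measurable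
    fun (x : Metric.sphere (0 : ErrorPattern m) 1) y =>
      modulate (c y) * likelihood (ρ ^ 2 / len m) (modulate (c y) + ρ * (x : ErrorPattern m) y) := by
  refine measurable_pi_lambda _ fun y => ?_
  have h : Measurable fun x : Metric.sphere (0 : ErrorPattern m) 1 => (x : ErrorPattern m) y :=
    (measurable_pi_apply y).comp
      ((PiLp.volume_preserving_ofLp _).measurable.comp measurable_subtype_coe)
  unfold likelihood
  fun_prop

lemma failureFraction_le {r m : ℕ} {c : Word m} (hc : c ∈ code r m) (ρ : ℝ) :
    failureFraction r m ρ c ≤ sphereLaw m ρ c {g | ¬ Good m r g} := by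
  refine le_trans ?_ (Measure.le_map_apply (measurable_sphereLaw_map m ρ c).aemeasurable _)
  rw [failureFraction, Measure.smul_apply, smul_eq_mul, ENNReal.div_eq_inv_mul]
  gcongr
  intro x hx hgood
  change ¬ Corrects r m (ρ ^ 2 / len m) c (ρ • (x : ErrorPattern m)) at hx
  refine hx (outputs_eq_singleton hc ?_)
  simpa using hgood

/-- The law of the likelihood of a transmitted `0`, expressed by `2 / σ²`, for normal noise. -/
noncomputable def awgnLaw (a : NNReal) : Measure ℝ := ProbabilityTheory.gaussianReal a (2 * a)

/-- With `a = 2 / σ²`, the signed likelihood is `a` plus `±a` times the error. For normal errors of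
variance `σ²` it has mean `a` and variance `2 * a`. The condition `2 ≤ m` makes the length a
multiple of 4. -/
lemma halfDominated_sphereLaw {m : ℕ} (hm : 2 ≤ m) {ρ : ℝ} (hρ : 0 < ρ) (c : Word m) {a : NNReal}
    (ha : (a : ℝ) = 2 * len m / ρ ^ 2) : HalfDominated 4 (sphereLaw m ρ c) (awgnLaw a) := by
  intro T A hT hA hdep
  obtain ⟨p, hp, hpm⟩ : ∃ p, 1 ≤ p ∧ 2 ^ m = 4 * p :=
    ⟨2 ^ (m - 2), Nat.one_le_two_pow, by
      conv_lhs => rw [show m = 2 + (m - 2) by omega, pow_add]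
      norm_num⟩
  have hlen : len m = 4 * p := by
    rw [len]
    exact_mod_cast hpm
  have hp0 : (0 : ℝ) < p := by exact_mod_cast hp
  set v : NNReal := ⟨ρ ^ 2 / (4 * p), by positivity⟩ with hvdef
  have hv : (v : ℝ) = ρ ^ 2 / (4 * p) := rfl
  set f : (Point m → ℝ) → (Point m → ℝ) := fun e y =>
    modulate (c y) * likelihood (ρ ^ 2 / len m) (modulate (c y) + e y) with hf
  have hfm : Measurable f := by
    refine measurable_pi_lambda _ fun y => ?_
    simp only [hf, likelihood]
    fun_prop
  have hdep' : DependsOn (· ∈ f ⁻¹' A) (T : Set (Point m)) := by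
    intro x y hxy
    exact hdep fun i hi => by simp only [hf, hxy i hi]
  have hκ : Fintype.card (Point m) = 4 * p := by rw [card_point, hpm]
  have hsph := toSphere_le hp hκ hρ hv (T := T) (by rw [← hpm]; exact hT) (hfm hA) hdep'
  have hgauss : Measure.pi (fun _ : Point m => ProbabilityTheory.gaussianReal 0 v) (f ⁻¹' A) =
      Measure.pi (fun _ : Point m => awgnLaw a) A := by
    have hmap : ∀ y, (ProbabilityTheory.gaussianReal 0 v).map (fun e =>
        modulate (c y) * likelihood (ρ ^ 2 / len m) (modulate (c y) + e)) = awgnLaw a := by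
      intro y
      have hsq := modulate_mul_self (c y)
      have hfun : (fun e => modulate (c y) * likelihood (ρ ^ 2 / len m) (modulate (c y) + e)) =
          (fun z => (a : ℝ) + z) ∘ fun e => (a * modulate (c y)) * e := by
        funext e
        simp only [Function.comp_apply, likelihood, ha, hlen]
        field_simp
        linear_combination hsq
      have hae : Measurable fun e : ℝ => (a * modulate (c y)) * e := by fun_prop
      have haz : Measurable fun z : ℝ => (a : ℝ) + z := by fun_prop
      rw [hfun, ← Measure.map_map haz hae, ProbabilityTheory.gaussianReal_map_const_mul,
        ProbabilityTheory.gaussianReal_map_const_add, awgnLaw, mul_zero, zero_add]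
      congr 1
      rw [← NNReal.coe_inj]
      push_cast
      change (a * modulate (c y)) ^ 2 * (v : ℝ) = 2 * a
      rw [mul_pow, sq (modulate (c y)), hsq, hv, ha, hlen]
      field_simp
    rw [← Measure.map_apply hfm hA]
    have := Measure.pi_map_pi (μ := fun _ : Point m => ProbabilityTheory.gaussianReal 0 v)
      (f := fun y e => modulate (c y) * likelihood (ρ ^ 2 / len m) (modulate (c y) + e))
      (hμ := fun y => by rw [hmap, awgnLaw]; infer_instance) (fun y => by
        refine Measurable.aemeasurable ?_
        unfold likelihood
        fun_prop)
    simp only [hmap] at this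
    rw [← this]
  have : Nontrivial (ErrorPattern m) := by
    have : Nonempty (Point m) := ⟨0⟩
    infer_instance
  have hne : (volume : Measure (ErrorPattern m)).toSphere Set.univ ≠ 0 := by
    simpa using (Metric.measure_ball_pos volume (0 : ErrorPattern m) one_pos).ne'
  rw [sphereLaw, Measure.map_apply (measurable_sphereLaw_map m ρ c) hA, Measure.smul_apply,
    smul_eq_mul, ← hgauss]
  refine (mul_le_mul_right hsph _).trans (le_of_eq ?_)
  rw [mul_comm, mul_assoc, ENNReal.mul_inv_cancel hne (measure_ne_top _ _), mul_one]

lemma len_pos (m : ℕ) : 0 < len m := by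
  unfold len
  positivity

lemma exists_awgn_parameter (m : ℕ) {ρ : ℝ} (hρ : 0 < ρ) :
    ∃ a : NNReal, a ≠ 0 ∧ (a : ℝ) = 2 * len m / ρ ^ 2 := by
  have h : 0 < 2 * len m / ρ ^ 2 := by
    have := len_pos m
    positivity
  exact ⟨⟨_, h.le⟩, fun h0 => h.ne' (congrArg NNReal.toReal h0), rfl⟩

lemma failureFraction_le_erasure {r m : ℕ} (hr : 1 ≤ r) (hrm : r < m) {ρ : ℝ} (hρ : 0 < ρ)
    {c : Word m} (hc : c ∈ code r m) :
    failureFraction r m ρ c ≤ 4 * ENNReal.ofReal (2 ^ m * 4 ^ (r + 1) *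
      (1 - (1 - Real.exp (-(len m / (2 * ρ ^ 2)))) ^ 2 ^ (r - 1)) ^ 2 ^ (m - r)) := by
  obtain ⟨a, ha0, ha⟩ := exists_awgn_parameter m hρ
  have hn := len_pos m
  refine (failureFraction_le hc ρ).trans (measure_not_good_le_erasure
    inferInstance (isSymmetricLaw_gaussian ha0)
    (halfDominated_sphereLaw (by omega) hρ c ha) hr hrm (Real.exp_pos _).le
    (Real.exp_le_one_iff.2 (neg_nonpos.2 (by positivity))) (le_of_eq ?_))
  rw [bhattacharyya_gaussian, ha]
  congr 2
  field_simp
  norm_num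

lemma failureFraction_le_exp {r m : ℕ} (hr : 1 ≤ r) (hrm : r < m) {ρ : ℝ} (hρ : 0 < ρ)
    {c : Word m} (hc : c ∈ code r m) {x : ℝ} (hx0 : 0 ≤ x) (hx : x ≤ 1 / (1 + ρ ^ 2 / len m)) :
    failureFraction r m ρ c ≤ 4 * ENNReal.ofReal (2 ^ m * 4 ^ (r + 1) *
      Real.exp (-(2 ^ (m - r) / 2 * (x * (1 - x)) ^ 2 ^ (r - 1)))) := by
  obtain ⟨a, ha0, ha⟩ := exists_awgn_parameter m hρ
  have hn := len_pos m
  have hx1 : x ≤ 1 := hx.trans ((div_le_one (by positivity)).2 (by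
    have : 0 ≤ ρ ^ 2 / len m := by positivity
    linarith))
  refine (failureFraction_le hc ρ).trans (measure_not_good_le_exp
    inferInstance (isSymmetricLaw_gaussian ha0)
    (halfDominated_sphereLaw (by omega) hρ c ha) hr hrm hx0 hx1
    (le_trans (ENNReal.ofReal_le_ofReal (hx.trans (le_of_eq ?_))) (le_sqSpread_gaussian ha0)))
  rw [ha]
  field_simp

/-! ### Codes of fixed rate. -/

lemma failureFraction_le_of_two_pow_mul_exp_le {r m : ℕ} (hr : 1 ≤ r) (hrm : r < m) {ρ : ℝ}
    (hρ : 0 < ρ) {c : Word m} (hc : c ∈ code r m)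
    (hz : 2 ^ r * Real.exp (-(len m / (2 * ρ ^ 2))) ≤ 1) (hrm' : m ≤ 4 * (m - r)) :
    failureFraction r m ρ c ≤ ENNReal.ofReal (16 * 8 ^ m * (1 / 2) ^ 2 ^ (m / 4)) := by
  refine (failureFraction_le_erasure hr hrm hρ hc).trans ?_
  set z := Real.exp (-(len m / (2 * ρ ^ 2))) with hzdef
  have hz0 : 0 < z := Real.exp_pos _
  have h2r : (2 : ℝ) ^ r = 2 * 2 ^ (r - 1) := by rw [← pow_succ', Nat.sub_add_cancel hr]
  have hz1 : z ≤ 1 := by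
    have : (1 : ℝ) ≤ 2 ^ r := one_le_pow₀ one_le_two
    nlinarith
  have hb := one_add_mul_le_pow (show -2 ≤ -z by linarith) (2 ^ (r - 1))
  rw [← sub_eq_add_neg] at hb
  push_cast at hb
  -- By Bernoulli's inequality the left side is at most `2 ^ (r - 1) * z`.
  have hbase : 1 - (1 - z) ^ 2 ^ (r - 1) ≤ 1 / 2 := by
    rw [h2r] at hz
    linarith
  have hbase0 : 0 ≤ 1 - (1 - z) ^ 2 ^ (r - 1) :=
    sub_nonneg.2 (pow_le_one₀ (by linarith) (by linarith))
  rw [show (4 : ENNReal) = ENNReal.ofReal 4 by simp, ← ENNReal.ofReal_mul (by norm_num)]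
  refine ENNReal.ofReal_le_ofReal ?_
  calc 4 * (2 ^ m * 4 ^ (r + 1) * (1 - (1 - z) ^ 2 ^ (r - 1)) ^ 2 ^ (m - r))
      ≤ 4 * (2 ^ m * 4 ^ (m + 1) * (1 / 2) ^ 2 ^ (m - r)) := by
        gcongr
        norm_num
    _ = 16 * (2 * 4) ^ m * (1 / 2) ^ 2 ^ (m - r) := by
        rw [mul_pow]
        ring
    _ ≤ 16 * 8 ^ m * (1 / 2) ^ 2 ^ (m / 4) := by
        rw [show (2 * 4 : ℝ) = 8 by norm_num]
        gcongr 16 * 8 ^ m * ?_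
        exact pow_le_pow_of_le_one (by norm_num) (by norm_num)
          (Nat.pow_le_pow_right two_pos (by omega))

lemma tendsto_eight_pow_mul_half_pow :
    Tendsto (fun m : ℕ => (16 : ℝ) * 8 ^ m * (1 / 2) ^ 2 ^ (m / 4)) atTop (𝓝 0) := by
  have hpow : ∀ k : ℕ, 7 ≤ k → 16 * k + 16 ≤ 2 ^ k := by
    intro k hk
    induction k, hk using Nat.le_induction with
    | base => norm_num
    | succ k hk ih =>
      rw [pow_succ]
      omega
  have hlim : Tendsto (fun m : ℕ => (16 : ℝ) * (1 / 2) ^ m) atTop (𝓝 0) := by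
    simpa using (tendsto_pow_atTop_nhds_zero_of_lt_one (r := (1 / 2 : ℝ)) (by norm_num)
      (by norm_num)).const_mul 16
  refine squeeze_zero' (Eventually.of_forall fun m => by positivity) ?_ hlim
  filter_upwards [eventually_ge_atTop 28] with m hm
  have h4 : 4 * m ≤ 2 ^ (m / 4) := le_trans (by omega) (hpow (m / 4) (by omega))
  calc (16 : ℝ) * 8 ^ m * (1 / 2) ^ 2 ^ (m / 4)
      ≤ 16 * 8 ^ m * (1 / 2) ^ (4 * m) := by
        gcongr 16 * 8 ^ m * ?_
        exact pow_le_pow_of_le_one (by norm_num) (by norm_num) h4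
    _ = 16 * (1 / 2) ^ m := by
        rw [pow_mul, mul_assoc, ← mul_pow]
        norm_num

/-- For `r ≥ 1` the conclusion means `ρ ^ 2 ≤ n / (2 * r * log 2)`. The factor `θ` absorbs the
excess of `2 * r` over `m`; both claims for fixed rate are instances. -/
lemma two_pow_mul_exp_le_one {r m : ℕ} (hm : 0 < m) {ρ θ : ℝ} (hρ : 0 < ρ)
    (h : ρ ≤ θ * √(len m / (m * Real.log 2))) (hθ : 2 * r * θ ^ 2 ≤ m) :
    2 ^ r * Real.exp (-(len m / (2 * ρ ^ 2))) ≤ 1 := by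
  have hn := len_pos m
  have hm0 : (0 : ℝ) < m := by exact_mod_cast hm
  have hl : 0 < Real.log 2 := Real.log_pos one_lt_two
  have hsq : ρ ^ 2 ≤ θ ^ 2 * (len m / (m * Real.log 2)) := by
    calc ρ ^ 2 ≤ (θ * √(len m / (m * Real.log 2))) ^ 2 := by gcongr
      _ = _ := by rw [mul_pow, Real.sq_sqrt (by positivity)]
  have hexp : r * Real.log 2 ≤ len m / (2 * ρ ^ 2) := by
    rw [le_div_iff₀ (by positivity)]
    calc r * Real.log 2 * (2 * ρ ^ 2)
        ≤ r * Real.log 2 * (2 * (θ ^ 2 * (len m / (m * Real.log 2)))) := by gcongr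
      _ = 2 * r * θ ^ 2 * (len m / m) := by field_simp
      _ ≤ m * (len m / m) := by gcongr
      _ = len m := by field_simp
  rw [← Real.exp_log (show (0 : ℝ) < 2 ^ r by positivity), Real.log_pow, ← Real.exp_add,
    Real.exp_le_one_iff]
  linarith

/-- Chebyshev's inequality for the number of ones of a random point of the cube. -/
lemma one_sub_rate_le {r m : ℕ} (hm : 0 < m) {δ : ℝ} (hδ : 0 < δ) (h : (1 / 2 + δ) * m ≤ r) :
    1 - rate r m ≤ 1 / (4 * δ ^ 2 * m) := by
  have hm0 : (0 : ℝ) < m := by exact_mod_cast hm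
  obtain ⟨x, hx⟩ : ∃ x : unitInterval, (x : ℝ) = 1 / 2 :=
    ⟨⟨1 / 2, Set.mem_Icc.2 (by norm_num)⟩, rfl⟩
  -- At `x = 1/2` the Bernstein weights are the binomial probabilities `(m.choose k) / 2 ^ m`, and
  -- the variance of `k / m` is `1 / (4 * m)`.
  have hvar := bernstein.variance hm.ne' x
  have hterm : ∀ k : Fin (m + 1), bernstein m k x = (m.choose k : ℝ) / len m := by
    intro k
    rw [bernstein_apply, hx, show (1 : ℝ) - 1 / 2 = 1 / 2 by norm_num, mul_assoc, ← pow_add,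
      Nat.add_sub_cancel' (by omega), len, one_div, inv_pow, div_eq_mul_inv]
  simp only [hterm, hx] at hvar
  have hsum : ∑ k ∈ Finset.range (m + 1), (m.choose k : ℝ) = len m := by
    rw [len]
    exact_mod_cast Nat.sum_range_choose m
  have hvar' : ∑ k ∈ Finset.range (m + 1), (1 / 2 - (k : ℝ) / m) ^ 2 * (m.choose k / len m) =
      1 / (4 * (m : ℝ)) := by
    rw [Finset.sum_range, ← show (1 / 2 : ℝ) * (1 - 1 / 2) / m = 1 / (4 * (m : ℝ)) by
      field_simp; norm_num]
    exact hvar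
  have hle : ∑ k ∈ Finset.range (m + 1), (m.choose k : ℝ) / len m ≤ rate r m +
      ∑ k ∈ Finset.range (m + 1), ((1 / 2 - (k : ℝ) / m) ^ 2 * (m.choose k / len m)) / δ ^ 2 := by
    have hn := len_pos m
    calc ∑ k ∈ Finset.range (m + 1), (m.choose k : ℝ) / len m
        ≤ ∑ k ∈ Finset.range (m + 1), ((if k < r + 1 then (m.choose k : ℝ) / len m else 0) +
            ((1 / 2 - (k : ℝ) / m) ^ 2 * (m.choose k / len m)) / δ ^ 2) := by
          refine Finset.sum_le_sum fun k _ => ?_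
          split_ifs with hk
          · exact le_add_of_nonneg_right (by positivity)
          · have hk' : (r : ℝ) ≤ k := by exact_mod_cast (by omega : r ≤ k)
            have hd : δ ≤ (k : ℝ) / m - 1 / 2 := by
              rw [le_sub_iff_add_le, le_div_iff₀ hm0]
              linarith
            rw [zero_add, le_div_iff₀ (by positivity), mul_comm]
            gcongr ?_ * _
            nlinarith
      _ ≤ _ := by
          rw [Finset.sum_add_distrib, ← Finset.sum_filter, rate, Finset.sum_div]
          gcongr
          intro k hk
          exact Finset.mem_range.2 (Finset.mem_filter.1 hk).2
  rw [← Finset.sum_div, ← Finset.sum_div, hsum, hvar', div_self (len_pos m).ne'] at hle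
  have : 1 / (4 * (m : ℝ)) / δ ^ 2 = 1 / (4 * δ ^ 2 * m) := by
    field_simp
  linarith

lemma eventually_lt_of_tendsto_rate {R : ℝ} (hR : R < 1) {m r : ℕ → ℕ}
    (hm : Tendsto m atTop atTop) (hrate : Tendsto (fun i => rate (r i) (m i)) atTop (𝓝 R))
    {δ : ℝ} (hδ : 0 < δ) : ∀ᶠ i in atTop, (r i : ℝ) < (1 / 2 + δ) * m i := by
  have hlim : Tendsto (fun i => (1 / (4 * δ ^ 2)) * (m i : ℝ)⁻¹) atTop (𝓝 0) := by
    simpa only [mul_zero, Function.comp_apply] using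
      ((tendsto_inv_atTop_nhds_zero_nat (𝕜 := ℝ)).comp hm).const_mul (1 / (4 * δ ^ 2))
  filter_upwards [hlim.eventually_lt_const (show 0 < (1 - R) / 2 by linarith),
    hrate.eventually_lt_const (show R < (1 + R) / 2 by linarith), hm.eventually_gt_atTop 0]
    with i h1 h2 h3
  by_contra hcon
  have := one_sub_rate_le h3 hδ (not_lt.1 hcon)
  rw [one_div, mul_inv, ← one_div] at this
  linarith

lemma eventually_one_le_of_tendsto_rate {R : ℝ} (hR : 0 < R) {m r : ℕ → ℕ}
    (hm : Tendsto m atTop atTop) (hrate : Tendsto (fun i => rate (r i) (m i)) atTop (𝓝 R)) :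
    ∀ᶠ i in atTop, 1 ≤ r i := by
  have hlim : Tendsto (fun i => (1 / 2 : ℝ) ^ m i) atTop (𝓝 0) :=
    (tendsto_pow_atTop_nhds_zero_of_lt_one (by norm_num) (by norm_num)).comp hm
  filter_upwards [hlim.eventually_lt_const (half_pos hR),
    hrate.eventually_const_lt (half_lt_self hR)] with i h1 h2
  by_contra hcon
  have h0 : r i = 0 := by omega
  rw [h0, rate] at h2
  simp only [zero_add, Finset.range_one, Finset.sum_singleton, Nat.choose_zero_right,
    Nat.cast_one, len] at h2
  rw [one_div_pow] at h1
  linarith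

lemma eventually_failureFraction_le_of_tendsto_rate {R : ℝ} (hR0 : 0 < R) {m r : ℕ → ℕ}
    (hm : Tendsto m atTop atTop) (hrate : Tendsto (fun i => rate (r i) (m i)) atTop (𝓝 R))
    {ε : ℝ} (hε : 0 < ε) : ∀ᶠ i in atTop, ∀ θ : ℝ, 2 * r i * θ ^ 2 ≤ m i → 4 * r i ≤ 3 * m i →
      ∀ ρ : ℝ, 0 < ρ → ρ ≤ θ * √(len (m i) / (m i * Real.log 2)) → ∀ c ∈ code (r i) (m i),
        failureFraction (r i) (m i) ρ c ≤ ENNReal.ofReal ε := by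
  filter_upwards [(tendsto_eight_pow_mul_half_pow.comp hm).eventually_le_const hε,
    eventually_one_le_of_tendsto_rate hR0 hm hrate, hm.eventually_gt_atTop 0]
    with i h1 h2 h3 θ hθ hrm ρ hρ hρB c hc
  exact (failureFraction_le_of_two_pow_mul_exp_le h2 (by omega) hρ hc
    (two_pow_mul_exp_le_one h3 hρ hρB hθ) (by omega)).trans (ENNReal.ofReal_le_ofReal h1)

/-! ### Codes of fixed order. -/

/-- The exponent of the failure bound at the noise power `q ^ 2`, with `q ^ 2 ^ r = d / (2 * m)`. -/
lemma exponent_lower_bound {r : ℕ} (hr : 1 ≤ r) {M d q : ℝ} (hM : 0 < M) (hq : 0 < q)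
    (hqd : q ^ 2 ^ r = d / (2 * M)) (hlarge : (10 * 2 ^ r) ^ 2 ^ r ≤ d / (2 * M)) :
    9 / 10 * M ≤ d / 2 * (1 / (1 + q ^ 2) * (1 - 1 / (1 + q ^ 2))) ^ 2 ^ (r - 1) := by
  have h1r : (1 : ℝ) ≤ 2 ^ r := one_le_pow₀ one_le_two
  have hqlarge : 10 * 2 ^ r ≤ q :=
    le_of_pow_le_pow_left₀ (by positivity) hq.le (hlarge.trans hqd.ge)
  have hs : 10 * 2 ^ r ≤ q ^ 2 := by nlinarith
  have hs0 : 0 < q ^ 2 := by positivity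
  have hQ : 2 ^ r = 2 * 2 ^ (r - 1) := by rw [← pow_succ', Nat.sub_add_cancel hr]
  have hd : d / 2 = M * (q ^ 2) ^ 2 ^ (r - 1) := by
    rw [← pow_mul, ← hQ, hqd]
    field_simp
  have hb := one_add_mul_le_pow (show -2 ≤ -(1 / (1 + q ^ 2)) by
    have : 1 / (1 + q ^ 2) ≤ 1 := (div_le_one (by positivity)).2 (by linarith)
    linarith) (2 ^ r)
  have hsmall : 2 ^ r * (1 / (1 + q ^ 2)) ≤ 1 / 10 := by
    rw [mul_one_div, div_le_div_iff₀ (by positivity) (by norm_num)]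
    linarith
  push_cast at hb
  -- With `x = 1 / (1 + q ^ 2)` one has `q ^ 2 * x = 1 - x`, so the exponent is exactly `M * (1 - x)
  -- ^ 2 ^ r`; Bernoulli's inequality then loses at most a tenth.
  have heq : d / 2 * (1 / (1 + q ^ 2) * (1 - 1 / (1 + q ^ 2))) ^ 2 ^ (r - 1) =
      M * (1 + -(1 / (1 + q ^ 2))) ^ 2 ^ r := by
    rw [hd, mul_assoc, ← mul_pow, hQ, pow_mul]
    congr 2
    field_simp
    ring
  rw [heq]
  nlinarith

lemma tendsto_two_pow_mul_exp (r : ℕ) : Tendsto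
    (fun m : ℕ => 4 * ((2 : ℝ) ^ m * 4 ^ (r + 1) * Real.exp (-(9 / 10 * m)))) atTop (𝓝 0) := by
  have hlt : 2 * Real.exp (-(9 / 10)) < 1 := by
    -- Any fraction above `log 2` would serve in place of `9 / 10`.
    have h2 : (2 : ℝ) < Real.exp (9 / 10) := by
      rw [← Real.log_lt_iff_lt_exp two_pos]
      linarith [Real.log_two_lt_d9]
    rw [Real.exp_neg, ← div_eq_mul_inv]
    exact (div_lt_one (Real.exp_pos _)).2 h2
  have h := (tendsto_pow_atTop_nhds_zero_of_lt_one (by positivity) hlt).const_mul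
    (4 * (4 : ℝ) ^ (r + 1))
  rw [mul_zero] at h
  refine h.congr fun m => ?_
  rw [mul_pow, ← Real.exp_nat_mul]
  ring_nf

lemma eventually_le_dist_div (r : ℕ) {K : ℝ} (hK : 0 < K) :
    ∀ᶠ m : ℕ in atTop, K ≤ dist r m / (2 * m) := by
  have h := tendsto_pow_const_div_const_pow_of_one_lt 1 (one_lt_two (α := ℝ))
  filter_upwards [h.eventually_lt_const (show 0 < 1 / (2 * K * 2 ^ r) by positivity),
    eventually_ge_atTop (r + 1)] with m hm hrm
  have hm0 : (0 : ℝ) < m := by exact_mod_cast (by omega : 0 < m)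
  rw [pow_one, div_lt_div_iff₀ (by positivity) (by positivity)] at hm
  rw [le_div_iff₀ (by positivity), dist]
  have hsplit : (2 : ℝ) ^ m = 2 ^ (m - r) * 2 ^ r := by
    rw [← pow_add, Nat.sub_add_cancel (by omega)]
  rw [hsplit] at hm
  have h2r : (0 : ℝ) < 2 ^ r := by positivity
  refine le_of_mul_le_mul_right ?_ h2r
  linarith

lemma eventually_failureFraction_le_of_fixed_order {r : ℕ} (hr : 1 ≤ r) {ε : ℝ} (hε : 0 < ε) :
    ∀ᶠ m : ℕ in atTop, ∀ ρ : ℝ, 0 < ρ →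
      ρ ≤ √(len m) * (dist r m / (2 * m)) ^ ((1 : ℝ) / 2 ^ r) →
      ∀ c ∈ code r m, failureFraction r m ρ c ≤ ENNReal.ofReal ε := by
  filter_upwards [(tendsto_two_pow_mul_exp r).eventually_le_const hε,
    eventually_le_dist_div r (show (0 : ℝ) < (10 * 2 ^ r) ^ 2 ^ r by positivity),
    eventually_gt_atTop r] with m hε' hlarge hrm ρ hρ hρB c hc
  have hn := len_pos m
  have hm0 : (0 : ℝ) < m := by exact_mod_cast (by omega : 0 < m)
  have hdpos : 0 < dist r m / (2 * m) := lt_of_lt_of_le (by positivity) hlarge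
  set q := (dist r m / (2 * m)) ^ ((1 : ℝ) / 2 ^ r) with hqdef
  have hq : 0 < q := Real.rpow_pos_of_pos hdpos _
  have hqd : q ^ 2 ^ r = dist r m / (2 * m) := by
    rw [hqdef, ← Real.rpow_natCast, ← Real.rpow_mul hdpos.le]
    push_cast
    rw [one_div_mul_cancel (by positivity), Real.rpow_one]
  have hexp := exponent_lower_bound hr hm0 hq hqd hlarge
  have hσ : ρ ^ 2 / len m ≤ q ^ 2 := by
    rw [div_le_iff₀ hn]
    calc ρ ^ 2 ≤ (√(len m) * q) ^ 2 := by gcongr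
      _ = q ^ 2 * len m := by rw [mul_pow, Real.sq_sqrt hn.le, mul_comm]
  refine (failureFraction_le_exp hr hrm hρ hc (x := 1 / (1 + q ^ 2)) (by positivity)
    (by gcongr)).trans ?_
  rw [show (4 : ENNReal) = ENNReal.ofReal 4 by simp, ← ENNReal.ofReal_mul (by norm_num)]
  refine ENNReal.ofReal_le_ofReal (le_trans ?_ hε')
  gcongr 4 * (2 ^ m * 4 ^ (r + 1) * Real.exp (-?_))
  exact hexp

end ReedMuller

theorem mainTheorem4 :
    (∀ r : ℕ, 1 ≤ r → ∀ ε : ℝ, 0 < ε → ∀ᶠ m : ℕ in atTop, ∀ ρ : ℝ, 0 < ρ →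
      ρ ≤ √(ReedMuller.len m) * (ReedMuller.dist r m / (2 * m)) ^ ((1 : ℝ) / 2 ^ r) →
      ∀ c ∈ ReedMuller.code r m, ReedMuller.failureFraction r m ρ c ≤ ENNReal.ofReal ε) ∧
    (∀ R : ℝ, 0 < R → R < 1 → ∀ m r : ℕ → ℕ, Tendsto m atTop atTop →
      Tendsto (fun i => ReedMuller.rate (r i) (m i)) atTop (𝓝 R) →
      (∀ η : ℝ, 0 < η → ∀ ε : ℝ, 0 < ε → ∀ᶠ i in atTop, ∀ ρ : ℝ, 0 < ρ →
        ρ ≤ (1 - η) * √(ReedMuller.len (m i) / (m i * Real.log 2)) →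
        ∀ c ∈ ReedMuller.code (r i) (m i),
          ReedMuller.failureFraction (r i) (m i) ρ c ≤ ENNReal.ofReal ε) ∧
      (∀ ε : ℝ, 0 < ε → ∀ᶠ i in atTop, 2 * r i ≤ m i → ∀ ρ : ℝ, 0 < ρ →
        ρ ≤ √(ReedMuller.len (m i) / (m i * Real.log 2)) →
        ∀ c ∈ ReedMuller.code (r i) (m i),
          ReedMuller.failureFraction (r i) (m i) ρ c ≤ ENNReal.ofReal ε)) := by
  refine ⟨fun r hr ε hε => ReedMuller.eventually_failureFraction_le_of_fixed_order hr hε,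
    fun R hR0 hR1 m r hm hrate => ⟨fun η hη ε hε => ?_, fun ε hε => ?_⟩⟩
  -- Capping `η` at `1 / 2` only enlarges the range of `ρ`. It keeps `1 - η'` positive and gives `r
  -- ≤ (1 + η') * m / 2 ≤ 3 * m / 4`.
  · have hη' : 0 < min η (1 / 2) := lt_min hη (by norm_num)
    filter_upwards [ReedMuller.eventually_failureFraction_le_of_tendsto_rate hR0 hm hrate hε,
      ReedMuller.eventually_lt_of_tendsto_rate hR1 hm hrate (half_pos hη')]
      with i h hr ρ hρ hρB c hc
    have hle := min_le_left η (1 / 2 : ℝ)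
    have hle' := min_le_right η (1 / 2 : ℝ)
    generalize min η (1 / 2 : ℝ) = η' at *
    have hmi : (0 : ℝ) ≤ m i := Nat.cast_nonneg _
    refine h (1 - η') ?_ ?_ ρ hρ (hρB.trans (by gcongr)) c hc
    · have h1 : (1 + η') * (1 - η') ^ 2 ≤ 1 := by nlinarith [mul_pos hη' hη']
      have h2 : 2 * (r i : ℝ) ≤ (1 + η') * m i := by linarith
      calc 2 * (r i : ℝ) * (1 - η') ^ 2 ≤ (1 + η') * m i * (1 - η') ^ 2 := by gcongr
        _ = (1 + η') * (1 - η') ^ 2 * m i := by ring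
        _ ≤ 1 * m i := by gcongr
        _ = m i := one_mul _
    · have : 4 * (r i : ℝ) ≤ 3 * m i := by nlinarith
      exact_mod_cast this
  · filter_upwards [ReedMuller.eventually_failureFraction_le_of_tendsto_rate hR0 hm hrate hε]
      with i h hr ρ hρ hρB c hc
    refine h 1 ?_ (by omega) ρ hρ (by rwa [one_mul]) c hc
    rw [one_pow, mul_one]
    exact_mod_cast hr
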